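/- For $\alpha\in[0,1]$ let $W_\alpha(x)=-\frac12\log(x_1^2+x_2^2)+\alpha\,\frac{x_1^2}{x_1^2+x_2^2}$ for $x=(x_1,x_2)\in\mathbb R^2\setminus\{0\}$ and $W_\alpha(0)=+\infty$. For a Borel probability measure $\mu\in\mathcal P(\mathbb R^2)$ let $$I_\alpha(\mu)=\frac12\iint_{\mathbb R^2\times\mathbb R^2}W_\alpha(x-y)\,d\mu(x)\,d\mu(y)+\frac12\int_{\mathbb R^2}|x|^2\,d\mu(x),$$ understood as $\frac12\iint\bigl(W_\alpha(x-y)+\frac12(|x|^2+|y|^2)\bigr)\,d\mu(x)\,d\mu(y)$. Then: 1. $I_\alpha$ is well defined on $\mathcal P(\mathbb R^2)$: for every $\mu\in\mathcal P(\mathbb R^2)$ the last integral exists in $(-\infty,+\infty]$. If $\int|x|^2\,d\mu<\infty$, then $\iint W_\alpha(x-y)\,d\mu(x)\,d\mu(y)$ also exists in $(-\infty,+\infty]$ and $I_\alpha(\mu)$ equals the two-term expression above; if $\int|x|^2\,d\mu=\infty$, then $I_\alpha(\mu)=+\infty$. 2. The set of $\mu\in\mathcal P(\mathbb R^2)$ with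 compact support and finite interaction energy $\iint W_\alpha(x-y)\,d\mu(x)\,d\mu(y)$ is convex, and on it $I_\alpha$ is finite and strictly convex. 3. $I_\alpha$ has a unique minimiser in $\mathcal P(\mathbb R^2)$, and this minimiser has compact support and finite energy $I_\alpha$. -/

import Mathlib

open MeasureTheory
open scoped NNReal ENNReal

noncomputable section

/-- The integral of an extended-real-valued function, `∫ f⁺ dμ - ∫ f⁻ dμ`. It is meaningful
under `HasExtIntegral μ f`. -/
def extIntegral {X : Type*} [MeasurableSpace X] (μ : Measure X) (f : X → EReal) : EReal :=
  ((∫⁻ x, (f x).toENNReal ∂μ : ℝ≥0∞) : EReal) - ((∫⁻ x, (-f x).toENNReal ∂μ : ℝ≥0∞) : EReal)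

/-- The integral of `f` exists as an extended real number: `f` is measurable, and the integrals of
its positive and of its negative part are not both infinite. -/
def HasExtIntegral {X : Type*} [MeasurableSpace X] (μ : Measure X) (f : X → EReal) : Prop :=
  AEMeasurable f μ ∧ (∫⁻ x, (f x).toENNReal ∂μ ≠ ⊤ ∨ ∫⁻ x, (-f x).toENNReal ∂μ ≠ ⊤)

/-- The Euclidean plane. -/
abbrev Plane : Type := EuclideanSpace ℝ (Fin 2)

/-- The probability measures on the plane. -/
def probMeasures : Set (Measure Plane) := {μ | IsProbabilityMeasure μ}

open Classical in
/-- The anisotropic interaction potential `W_α`, with `W_α(0) = +∞`. -/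
def potentialW (α : ℝ) (x : Plane) : EReal :=
  if x = 0 then ⊤
  else ((-(1 / 2) * Real.log (x 0 ^ 2 + x 1 ^ 2)
      + α * (x 0 ^ 2 / (x 0 ^ 2 + x 1 ^ 2)) : ℝ) : EReal)

/-- The integrand `(x, y) ↦ W_α(x - y)` of the interaction energy. -/
def interactionKernel (α : ℝ) (p : Plane × Plane) : EReal := potentialW α (p.1 - p.2)

/-- The interaction energy `∬ W_α(x - y) dμ(x) dμ(y)`. -/
def interactionEnergy (α : ℝ) (μ : Measure Plane) : EReal :=
  extIntegral (μ.prod μ) (interactionKernel α)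

/-- The second moment `∫ |x|² dμ(x)`. -/
def secondMoment (μ : Measure Plane) : EReal :=
  extIntegral μ (fun x => ((‖x‖ ^ 2 : ℝ) : EReal))

/-- The integrand `W_α(x - y) + (|x|² + |y|²) / 2` of the total energy. -/
def energyKernel (α : ℝ) (p : Plane × Plane) : EReal :=
  potentialW α (p.1 - p.2) + (((‖p.1‖ ^ 2 + ‖p.2‖ ^ 2) / 2 : ℝ) : EReal)

/-- The energy `I_α(μ)`. Both terms `½ ∬ W_α(x - y) dμ dμ` and `½ ∫ |x|² dμ` are put under one
double integral, since for heavy-tailed `μ` their sum can have the form `-∞ + ∞`. -/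
def energy (α : ℝ) (μ : Measure Plane) : EReal :=
  ((1 / 2 : ℝ) : EReal) * extIntegral (μ.prod μ) (energyKernel α)

/-- The probability measures with compact support and finite interaction energy. -/
def compactFiniteClass (α : ℝ) : Set (Measure Plane) :=
  {μ | IsProbabilityMeasure μ ∧ IsCompact μ.support ∧
    HasExtIntegral (μ.prod μ) (interactionKernel α) ∧
    interactionEnergy α μ ≠ ⊥ ∧ interactionEnergy α μ ≠ ⊤}

/-- `μ` minimises `I_α` among all probability measures on the plane. -/
def IsEnergyMinimiser (α : ℝ) (μ : Measure Plane) : Prop :=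
  μ ∈ probMeasures ∧ IsMinOn (energy α) probMeasures μ

end

/-!
The energy is studied through the nonnegative kernel `shiftedKernel`, i.e.
`W_α(x - y) + (|x|² + |y|²) / 2 + 1 ≥ (|x|² + |y|²) / 4`, and the mutual energies
`mutualEnergy α μ ν ∈ [0, +∞]`. Since the lower bound of the kernel is explicit, all the
extended-real integrals of the statement are obtained from `mutualEnergy` by subtracting a finite
constant (`energy_eq`, `interactionEnergy_eq`).

Strict convexity is the positivity of the interaction energy of `μ - ν`, for distinct probability
measures of finite energy (`two_mul_mutualEnergy_lt`). Formally, the Fourier transform of `W_α` is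
`((1 - α) ξ₁² + (1 + α) ξ₂²) / |ξ|⁴` up to a constant, and this is positive off the axis `ξ₂ = 0`
for `0 ≤ α ≤ 1`. To avoid distributions, write `q = anisoForm α` for the quadratic form in the
numerator and represent the kernel in three layers: the regularisation `regPotential α ε` of `W_α`
has `ε`-derivative `-resolventKernel α ε / 2`; the kernel `resolventKernel α s` is the Laplace
transform in `t` of `gaussKernel α t`, which is `(1 - t q) exp (-t |·|²)`; and this last function
is, up to a positive factor, the Fourier transform of `q` times a Gaussian. So its energy on
`μ - ν` is a weighted `L²` norm of the difference of the characteristic functions, and it vanishes only if `μ = ν`. The energy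
of `regPotential α R` on `μ - ν` tends to zero as `R → ∞`, because `μ - ν` has mass zero and finite
second moments; hence the energies for `ε ≤ 1` are bounded below by a positive constant, and the
limit `ε → 0` is taken with Fatou's lemma on the cross terms and dominated convergence on the
diagonal ones.

Minimisers exist by the direct method: `shiftedKernel` is continuous into `[0, +∞]`, so the energy
is lower semicontinuous for weak convergence, its sublevel sets are tight, and Prokhorov's theorem
makes them compact; the uniform measure on a segment has finite energy. A minimiser has compact
support because conditioning on a large ball would decrease its energy, and it is unique by strict
convexity.
-/

open Filter Topology

/-! ### Integrals of extended-real functions with an integrable lower bound -/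

theorem toENNReal_add_coe_add_toENNReal_neg {g : EReal} {h : ℝ} (h0 : 0 ≤ h)
    (hgh : 0 ≤ g + (h : EReal)) :
    (g + (h : EReal)).toENNReal + (-g).toENNReal = g.toENNReal + ENNReal.ofReal h := by
  induction g with
  | bot => simp at hgh
  | top => simp
  | coe r =>
    rw [← EReal.coe_add, ← EReal.coe_neg]
    rw [← EReal.coe_add] at hgh
    have hrh : 0 ≤ r + h := by exact_mod_cast hgh
    simp only [EReal.real_coe_toENNReal]
    rcases le_total 0 r with hr | hr
    · rw [ENNReal.ofReal_add hr h0, ENNReal.ofReal_of_nonpos (neg_nonpos.2 hr), add_zero]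
    · rw [ENNReal.ofReal_of_nonpos hr, zero_add, ← ENNReal.ofReal_add hrh (neg_nonneg.2 hr)]
      ring_nf

/-- If `-h ≤ g` with `h ≥ 0` integrable, the integral of `g` exists in `(-∞, +∞]`, and it is
obtained by integrating the nonnegative function `g + h` and subtracting `∫ h`. -/
theorem extIntegral_eq_lintegral_sub {X : Type*} [MeasurableSpace X] {μ : Measure X}
    {g : X → EReal} {h : X → ℝ} (hg : Measurable g) (hh : Integrable h μ) (h0 : ∀ x, 0 ≤ h x)
    (hgh : ∀ x, 0 ≤ g x + (h x : EReal)) :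
    HasExtIntegral μ g ∧
      extIntegral μ g = ((∫⁻ x, (g x + (h x : EReal)).toENNReal ∂μ : ℝ≥0∞) : EReal)
        - ((∫ x, h x ∂μ : ℝ) : EReal) := by
  have hpt := fun x => toENNReal_add_coe_add_toENNReal_neg (h0 x) (hgh x)
  have hh' : ∫⁻ x, ENNReal.ofReal (h x) ∂μ = ENNReal.ofReal (∫ x, h x ∂μ) :=
    (ofReal_integral_eq_lintegral_ofReal hh (ae_of_all _ h0)).symm
  have hneg : ∫⁻ x, (-g x).toENNReal ∂μ ≠ ⊤ := by
    refine ne_top_of_le_ne_top (hh' ▸ ENNReal.ofReal_ne_top) (lintegral_mono fun x => ?_)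
    rw [← EReal.real_coe_toENNReal]
    refine EReal.toENNReal_le_toENNReal ?_
    rw [EReal.neg_le]
    have := hgh x
    generalize g x = a at this
    induction a with
    | bot => simp at this
    | top => simp
    | coe r => norm_cast at this ⊢; linarith
  refine ⟨⟨hg.aemeasurable, Or.inr hneg⟩, ?_⟩
  have key : ∫⁻ x, (g x + (h x : EReal)).toENNReal ∂μ + ∫⁻ x, (-g x).toENNReal ∂μ
      = ∫⁻ x, (g x).toENNReal ∂μ + ENNReal.ofReal (∫ x, h x ∂μ) := by
    rw [← hh', ← lintegral_add_right _ (by fun_prop : Measurable fun x => (-g x).toENNReal),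
      ← lintegral_add_right' _ hh.1.aemeasurable.ennreal_ofReal]
    exact lintegral_congr hpt
  have hint : 0 ≤ ∫ x, h x ∂μ := integral_nonneg h0
  unfold extIntegral
  generalize ∫⁻ x, (g x + (h x : EReal)).toENNReal ∂μ = A at *
  generalize ∫⁻ x, (-g x).toENNReal ∂μ = B at *
  generalize ∫⁻ x, (g x).toENNReal ∂μ = C at *
  generalize ∫ x, h x ∂μ = H at *
  lift B to ℝ≥0 using hneg
  rcases eq_or_ne C ⊤ with rfl | hC
  · have : A = ⊤ := by
      by_contra hA
      lift A to ℝ≥0 using hA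
      rw [top_add, ← ENNReal.coe_add] at key
      exact ENNReal.coe_ne_top key
    subst this
    simp [EReal.coe_ennreal_top]
  · lift C to ℝ≥0 using hC
    have hA : A ≠ ⊤ := by
      rintro rfl
      rw [top_add] at key
      exact (ENNReal.add_ne_top.2 ⟨ENNReal.coe_ne_top, ENNReal.ofReal_ne_top⟩) key.symm
    lift A to ℝ≥0 using hA
    have := congrArg ENNReal.toReal key
    rw [ENNReal.toReal_add (by simp) (by simp), ENNReal.toReal_add (by simp) (by simp),
      ENNReal.toReal_ofReal hint] at this
    simp only [ENNReal.coe_toReal] at this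
    have e : ∀ a : ℝ≥0, (((a : ℝ≥0∞) : EReal)) = ((a : ℝ) : EReal) := fun a => rfl
    rw [e, e, e, ← EReal.coe_sub, ← EReal.coe_sub]
    congr 1
    linarith

/-! ### The shifted kernel -/

/-- The values of `W_α` off the origin, as real numbers. -/
noncomputable def realPotential (α : ℝ) (x : Plane) : ℝ :=
  -(1 / 2) * Real.log (x 0 ^ 2 + x 1 ^ 2) + α * (x 0 ^ 2 / (x 0 ^ 2 + x 1 ^ 2))

open Classical in
/-- The kernel `W_α(x - y) + (|x|² + |y|²) / 2 + 1`, which takes values in `[0, +∞]`. -/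
noncomputable def shiftedKernel (α : ℝ) (p : Plane × Plane) : ℝ≥0∞ :=
  if p.1 = p.2 then ⊤
  else ENNReal.ofReal (realPotential α (p.1 - p.2) + (‖p.1‖ ^ 2 + ‖p.2‖ ^ 2) / 2 + 1)

theorem Plane.norm_sq_eq (x : Plane) : ‖x‖ ^ 2 = x 0 ^ 2 + x 1 ^ 2 := by
  simp [EuclideanSpace.norm_sq_eq]

theorem Plane.sq_add_sq_pos {x : Plane} (hx : x ≠ 0) : 0 < x 0 ^ 2 + x 1 ^ 2 := by
  rw [← Plane.norm_sq_eq]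
  positivity

theorem Plane.norm_sub_sq_le (x y : Plane) : ‖x - y‖ ^ 2 ≤ 2 * (‖x‖ ^ 2 + ‖y‖ ^ 2) := by
  have := parallelogram_law_with_norm ℝ x y
  nlinarith [sq_nonneg ‖x + y‖]

/-- The coefficient `1 / 8` makes the logarithm cost at most half of the confinement
`(|x|² + |y|²) / 2` when `z = |x - y|²`. -/
theorem Real.half_log_le_eighth (z : ℝ) (hz : 0 ≤ z) : 1 / 2 * Real.log (1 + z) ≤ z / 8 + 1 := by
  have h1 : Real.log ((1 + z) / 4) ≤ (1 + z) / 4 - 1 := Real.log_le_sub_one_of_pos (by positivity)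
  have h2 : Real.log 4 ≤ 2 := by
    have : Real.log 2 ≤ 2 - 1 := Real.log_le_sub_one_of_pos (by norm_num)
    rw [show (4 : ℝ) = 2 ^ 2 by norm_num, Real.log_pow]
    push_cast
    linarith
  rw [Real.log_div (by positivity) (by norm_num)] at h1
  linarith

theorem realPotential_lower_bound {α : ℝ} (hα : 0 ≤ α) {x y : Plane} (hxy : x ≠ y) :
    (‖x‖ ^ 2 + ‖y‖ ^ 2) / 4
      ≤ realPotential α (x - y) + (‖x‖ ^ 2 + ‖y‖ ^ 2) / 2 + 1 := by
  have hpos := Plane.sq_add_sq_pos (sub_ne_zero.2 hxy)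
  have h1 := Plane.norm_sub_sq_le x y
  have h2 := Real.half_log_le_eighth _ hpos.le
  have h3 : Real.log ((x - y) 0 ^ 2 + (x - y) 1 ^ 2)
      ≤ Real.log (1 + ((x - y) 0 ^ 2 + (x - y) 1 ^ 2)) := Real.log_le_log hpos (by linarith)
  have h4 : 0 ≤ α * ((x - y) 0 ^ 2 / ((x - y) 0 ^ 2 + (x - y) 1 ^ 2)) := by positivity
  rw [Plane.norm_sq_eq (x - y)] at h1
  unfold realPotential
  linarith

theorem le_shiftedKernel {α : ℝ} (hα : 0 ≤ α) (p : Plane × Plane) :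
    ENNReal.ofReal ((‖p.1‖ ^ 2 + ‖p.2‖ ^ 2) / 4) ≤ shiftedKernel α p := by
  unfold shiftedKernel
  split_ifs with h
  · exact le_top
  · exact ENNReal.ofReal_le_ofReal (realPotential_lower_bound hα h)

theorem shiftedKernel_swap (α : ℝ) (p : Plane × Plane) :
    shiftedKernel α p.swap = shiftedKernel α p := by
  unfold shiftedKernel realPotential
  have e : ∀ i, (p.2 - p.1) i ^ 2 = (p.1 - p.2) i ^ 2 := fun i => by
    simp only [PiLp.sub_apply]; ring
  simp only [Prod.fst_swap, Prod.snd_swap, e, eq_comm (a := p.2), add_comm (‖p.2‖ ^ 2)]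

theorem interactionKernel_add {α : ℝ} (hα : 0 ≤ α) (p : Plane × Plane) :
    0 ≤ interactionKernel α p + (((‖p.1‖ ^ 2 + ‖p.2‖ ^ 2) / 2 + 1 : ℝ) : EReal) ∧
      (interactionKernel α p + (((‖p.1‖ ^ 2 + ‖p.2‖ ^ 2) / 2 + 1 : ℝ) : EReal)).toENNReal
        = shiftedKernel α p := by
  unfold interactionKernel potentialW shiftedKernel
  by_cases h : p.1 = p.2
  · rw [if_pos h, if_pos (sub_eq_zero.2 h), EReal.top_add_coe]
    exact ⟨le_top, rfl⟩
  · have h' : p.1 - p.2 ≠ 0 := sub_ne_zero.2 h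
    rw [if_neg h, if_neg h', ← EReal.coe_add, EReal.real_coe_toENNReal, ← add_assoc]
    refine ⟨?_, rfl⟩
    have := realPotential_lower_bound hα h
    unfold realPotential at this
    have h0 : 0 ≤ (‖p.1‖ ^ 2 + ‖p.2‖ ^ 2) / 4 := by positivity
    exact_mod_cast h0.trans this

theorem energyKernel_add_one {α : ℝ} (hα : 0 ≤ α) (p : Plane × Plane) :
    0 ≤ energyKernel α p + ((1 : ℝ) : EReal) ∧
      (energyKernel α p + ((1 : ℝ) : EReal)).toENNReal = shiftedKernel α p := by
  have := interactionKernel_add hα p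
  rwa [EReal.coe_add, ← add_assoc] at this

theorem measurable_interactionKernel (α : ℝ) : Measurable (interactionKernel α) := by
  unfold interactionKernel potentialW
  refine Measurable.ite (measurableSet_eq_fun (by fun_prop) (by fun_prop)) (by fun_prop) ?_
  refine measurable_coe_real_ereal.comp ?_
  fun_prop

theorem measurable_energyKernel (α : ℝ) : Measurable (energyKernel α) :=
  (measurable_interactionKernel α).add
    (measurable_coe_real_ereal.comp (by fun_prop))

/-- The mutual energy `∬ (W_α(x - y) + (|x|² + |y|²) / 2 + 1) dμ(x) dν(y)` in `[0, +∞]`. -/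
noncomputable def mutualEnergy (α : ℝ) (μ ν : Measure Plane) : ℝ≥0∞ :=
  ∫⁻ p, shiftedKernel α p ∂(μ.prod ν)

theorem energy_eq {α : ℝ} (hα : 0 ≤ α) (μ : Measure Plane) [IsProbabilityMeasure μ] :
    HasExtIntegral (μ.prod μ) (energyKernel α) ∧
      energy α μ = ((1 / 2 : ℝ) : EReal) * ((mutualEnergy α μ μ : EReal) - ((1 : ℝ) : EReal)) := by
  have := extIntegral_eq_lintegral_sub (μ := μ.prod μ) (h := fun _ => 1)
    (measurable_energyKernel α) (integrable_const _) (fun _ => zero_le_one)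
    (fun p => (energyKernel_add_one hα p).1)
  refine ⟨this.1, ?_⟩
  rw [energy, this.2, mutualEnergy]
  simp only [(energyKernel_add_one hα _).2]
  simp

theorem energy_of_ne_top {α : ℝ} (hα : 0 ≤ α) {μ : Measure Plane} [IsProbabilityMeasure μ]
    (h : mutualEnergy α μ μ ≠ ⊤) :
    energy α μ = ((1 / 2 * ((mutualEnergy α μ μ).toReal - 1) : ℝ) : EReal) := by
  rw [(energy_eq hα μ).2]
  lift mutualEnergy α μ μ to ℝ≥0 using h with a
  rfl

theorem energy_of_eq_top {α : ℝ} (hα : 0 ≤ α) {μ : Measure Plane} [IsProbabilityMeasure μ]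
    (h : mutualEnergy α μ μ = ⊤) : energy α μ = ⊤ := by
  rw [(energy_eq hα μ).2, h, EReal.coe_ennreal_top, EReal.top_sub_coe,
    EReal.coe_mul_top_of_pos (by norm_num)]

theorem energy_ne_top_iff {α : ℝ} (hα : 0 ≤ α) {μ : Measure Plane} [IsProbabilityMeasure μ] :
    energy α μ ≠ ⊤ ↔ mutualEnergy α μ μ ≠ ⊤ := by
  refine ⟨fun h h' => h (energy_of_eq_top hα h'), fun h => ?_⟩
  rw [energy_of_ne_top hα h]
  exact EReal.coe_ne_top _

theorem energy_ne_bot {α : ℝ} (hα : 0 ≤ α) (μ : Measure Plane) [IsProbabilityMeasure μ] :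
    energy α μ ≠ ⊥ := by
  by_cases h : mutualEnergy α μ μ = ⊤
  · rw [energy_of_eq_top hα h]; exact top_ne_bot
  · rw [energy_of_ne_top hα h]; exact EReal.coe_ne_bot _

theorem energy_le_energy_iff {α : ℝ} (hα : 0 ≤ α) {μ ν : Measure Plane} [IsProbabilityMeasure μ]
    [IsProbabilityMeasure ν] :
    energy α μ ≤ energy α ν ↔ mutualEnergy α μ μ ≤ mutualEnergy α ν ν := by
  by_cases hν : mutualEnergy α ν ν = ⊤
  · simp [hν, energy_of_eq_top hα hν]
  by_cases hμ : mutualEnergy α μ μ = ⊤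
  · simp [hν, hμ, energy_of_eq_top hα hμ, energy_ne_top_iff hα]
  · rw [energy_of_ne_top hα hν, energy_of_ne_top hα hμ, EReal.coe_le_coe_iff,
      ← ENNReal.toReal_le_toReal hμ hν]
    constructor <;> intro h <;> linarith

/-! ### Second moments -/

theorem secondMoment_eq (μ : Measure Plane) :
    secondMoment μ = ((∫⁻ x, ENNReal.ofReal (‖x‖ ^ 2) ∂μ : ℝ≥0∞) : EReal) := by
  have : ∀ x : Plane, ENNReal.ofReal (-‖x‖ ^ 2) = 0 := fun x =>
    ENNReal.ofReal_of_nonpos (by rw [Left.neg_nonpos_iff]; positivity)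
  simp only [secondMoment, extIntegral, ← EReal.coe_neg, EReal.real_coe_toENNReal, this,
    lintegral_zero, EReal.coe_ennreal_zero, sub_zero]

theorem integrable_norm_sq_iff {μ : Measure Plane} :
    Integrable (fun x : Plane => ‖x‖ ^ 2) μ ↔ secondMoment μ ≠ ⊤ := by
  rw [secondMoment_eq, Ne, EReal.coe_ennreal_eq_top_iff]
  have hm : AEStronglyMeasurable (fun x : Plane => ‖x‖ ^ 2) μ :=
    (by fun_prop : Continuous fun x : Plane => ‖x‖ ^ 2).aestronglyMeasurable
  exact (lintegral_ofReal_ne_top_iff_integrable hm (ae_of_all _ fun x => by positivity)).symm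

theorem integrable_norm_sq_of_mutualEnergy {α : ℝ} (hα : 0 ≤ α) {μ ν : Measure Plane}
    [IsProbabilityMeasure μ] [IsProbabilityMeasure ν] (h : mutualEnergy α μ ν ≠ ⊤) :
    Integrable (fun x : Plane => ‖x‖ ^ 2) μ := by
  have h1 : ∫⁻ p : Plane × Plane, ENNReal.ofReal (‖p.1‖ ^ 2 / 4) ∂(μ.prod ν) ≠ ⊤ := by
    refine ne_top_of_le_ne_top h (lintegral_mono fun p => le_trans ?_ (le_shiftedKernel hα p))
    exact ENNReal.ofReal_le_ofReal (by nlinarith [sq_nonneg ‖p.2‖])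
  have h2 : Integrable (fun p : Plane × Plane => ‖p.1‖ ^ 2 / 4) (μ.prod ν) :=
    (lintegral_ofReal_ne_top_iff_integrable
      ((by fun_prop : Continuous fun p : Plane × Plane => ‖p.1‖ ^ 2 / 4).aestronglyMeasurable)
      (ae_of_all _ fun p => by positivity)).1 h1
  have h3 : Integrable (fun x : Plane => ‖x‖ ^ 2 / 4) μ := by
    have := h2.integral_prod_left
    simpa using this
  simpa using h3.mul_const 4

theorem interactionEnergy_eq {α : ℝ} (hα : 0 ≤ α) {μ : Measure Plane} [IsProbabilityMeasure μ]
    (h : Integrable (fun x : Plane => ‖x‖ ^ 2) μ) :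
    HasExtIntegral (μ.prod μ) (interactionKernel α) ∧
      interactionEnergy α μ
        = (mutualEnergy α μ μ : EReal) - ((∫ x, ‖x‖ ^ 2 ∂μ + 1 : ℝ) : EReal) := by
  have i1 : Integrable (fun p : Plane × Plane => ‖p.1‖ ^ 2) (μ.prod μ) := h.comp_fst μ
  have i2 : Integrable (fun p : Plane × Plane => ‖p.2‖ ^ 2) (μ.prod μ) := h.comp_snd μ
  have i12 : Integrable (fun p : Plane × Plane => (‖p.1‖ ^ 2 + ‖p.2‖ ^ 2) / 2) (μ.prod μ) :=
    (i1.add i2).div_const 2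
  have := extIntegral_eq_lintegral_sub (μ := μ.prod μ)
    (h := fun p => (‖p.1‖ ^ 2 + ‖p.2‖ ^ 2) / 2 + 1)
    (measurable_interactionKernel α) (i12.add (integrable_const 1))
    (fun _ => by positivity) (fun p => (interactionKernel_add hα p).1)
  refine ⟨this.1, ?_⟩
  rw [interactionEnergy, this.2, mutualEnergy]
  simp only [(interactionKernel_add hα _).2]
  congr 2
  rw [integral_add i12 (integrable_const 1), integral_div,
    integral_add i1 i2, integral_fun_fst (fun x : Plane => ‖x‖ ^ 2),
    integral_fun_snd (fun x : Plane => ‖x‖ ^ 2)]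
  simp

theorem energy_eq_interactionEnergy_add {α : ℝ} (hα : 0 ≤ α) {μ : Measure Plane}
    [IsProbabilityMeasure μ] (h : Integrable (fun x : Plane => ‖x‖ ^ 2) μ) :
    energy α μ = ((1 / 2 : ℝ) : EReal) * interactionEnergy α μ
      + ((1 / 2 : ℝ) : EReal) * secondMoment μ := by
  have hM : secondMoment μ = ((∫ x, ‖x‖ ^ 2 ∂μ : ℝ) : EReal) := by
    rw [secondMoment_eq,
      ← ofReal_integral_eq_lintegral_ofReal h (ae_of_all _ fun x => by positivity),
      EReal.coe_ennreal_ofReal, max_eq_left (integral_nonneg fun x => by positivity)]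
  rw [(energy_eq hα μ).2, (interactionEnergy_eq hα h).2, hM]
  by_cases hP : mutualEnergy α μ μ = ⊤
  · rw [hP, EReal.coe_ennreal_top, EReal.top_sub_coe, EReal.top_sub_coe,
      EReal.coe_mul_top_of_pos (by norm_num), ← EReal.coe_mul, EReal.top_add_coe]
  · lift mutualEnergy α μ μ to ℝ≥0 using hP with a
    have e : (((a : ℝ≥0∞) : EReal)) = ((a : ℝ) : EReal) := rfl
    rw [e]
    norm_cast
    ring

/-- Compactly supported measures have finite second moment, so that the interaction energy and
`mutualEnergy` are finite simultaneously. -/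
theorem mem_compactFiniteClass_iff {α : ℝ} (hα : 0 ≤ α) {μ : Measure Plane} :
    μ ∈ compactFiniteClass α ↔
      IsProbabilityMeasure μ ∧ IsCompact μ.support ∧ mutualEnergy α μ μ ≠ ⊤ := by
  have hint : ∀ [IsProbabilityMeasure μ], IsCompact μ.support →
      Integrable (fun x : Plane => ‖x‖ ^ 2) μ := by
    intro _ hc
    obtain ⟨C, hC⟩ := hc.isBounded.exists_norm_le
    refine Integrable.of_bound (C := C ^ 2)
      (by fun_prop : Continuous fun x : Plane => ‖x‖ ^ 2).aestronglyMeasurable ?_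
    filter_upwards [Measure.support_mem_ae (μ := μ)] with x hx
    rw [Real.norm_of_nonneg (by positivity)]
    gcongr
    exact hC x hx
  constructor
  · rintro ⟨hp, hc, -, -, h⟩
    refine ⟨hp, hc, fun hP => h ?_⟩
    rw [(interactionEnergy_eq hα (hint hc)).2, hP, EReal.coe_ennreal_top, EReal.top_sub_coe]
  · rintro ⟨hp, hc, hP⟩
    obtain ⟨h1, h2⟩ := interactionEnergy_eq hα (hint hc)
    refine ⟨hp, hc, h1, ?_⟩
    rw [h2]
    lift mutualEnergy α μ μ to ℝ≥0 using hP with a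
    have e : (((a : ℝ≥0∞) : EReal)) = ((a : ℝ) : EReal) := rfl
    rw [e, ← EReal.coe_sub]
    exact ⟨EReal.coe_ne_bot _, EReal.coe_ne_top _⟩

theorem energy_well_defined {α : ℝ} (hα : 0 ≤ α) (μ : Measure Plane) [IsProbabilityMeasure μ] :
    HasExtIntegral (μ.prod μ) (energyKernel α) ∧ energy α μ ≠ ⊥ ∧
      (secondMoment μ ≠ ⊤ →
        HasExtIntegral (μ.prod μ) (interactionKernel α) ∧ interactionEnergy α μ ≠ ⊥ ∧
        energy α μ = ((1 / 2 : ℝ) : EReal) * interactionEnergy α μ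
          + ((1 / 2 : ℝ) : EReal) * secondMoment μ) ∧
      (secondMoment μ = ⊤ → energy α μ = ⊤) := by
  refine ⟨(energy_eq hα μ).1, energy_ne_bot hα μ, fun h => ?_, fun h => ?_⟩
  · have hi := integrable_norm_sq_iff.2 h
    refine ⟨(interactionEnergy_eq hα hi).1, ?_, energy_eq_interactionEnergy_add hα hi⟩
    rw [(interactionEnergy_eq hα hi).2, sub_eq_add_neg, ← EReal.coe_neg, Ne, EReal.add_eq_bot_iff]
    exact not_or.2 ⟨EReal.coe_ennreal_ne_bot _, EReal.coe_ne_bot _⟩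
  · refine energy_of_eq_top hα (by_contra fun h' => ?_)
    exact integrable_norm_sq_iff.1 (integrable_norm_sq_of_mutualEnergy hα h') h

/-! ### The energy of a difference of two measures -/

/-- The double integral `∬ k d(μ - ν) d(μ - ν)`, expanded into four double integrals. -/
noncomputable def diffForm (μ ν : Measure Plane) (k : Plane × Plane → ℝ) : ℝ :=
  (∫ p, k p ∂(μ.prod μ)) + (∫ p, k p ∂(ν.prod ν)) - (∫ p, k p ∂(μ.prod ν)) - ∫ p, k p ∂(ν.prod μ)

theorem diffForm_const_mul (μ ν : Measure Plane) (c : ℝ) (k : Plane × Plane → ℝ) :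
    diffForm μ ν (fun p => c * k p) = c * diffForm μ ν k := by
  simp only [diffForm, integral_const_mul]
  ring

section diffForm

variable {μ ν : Measure Plane} [IsProbabilityMeasure μ] [IsProbabilityMeasure ν]

/-- Integrability with respect to the four products of `μ` and `ν` at once. -/
theorem integrable_sum_prod_sum_iff {k : Plane × Plane → ℝ} :
    Integrable k ((μ + ν).prod (μ + ν)) ↔
      (Integrable k (μ.prod μ) ∧ Integrable k (ν.prod ν)) ∧
        (Integrable k (μ.prod ν) ∧ Integrable k (ν.prod μ)) := by
  rw [Measure.prod_add, Measure.add_prod, Measure.add_prod]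
  simp only [integrable_add_measure]
  tauto

theorem diffForm_sub {k l : Plane × Plane → ℝ} (hk : Integrable k ((μ + ν).prod (μ + ν)))
    (hl : Integrable l ((μ + ν).prod (μ + ν))) :
    diffForm μ ν (fun p => k p - l p) = diffForm μ ν k - diffForm μ ν l := by
  obtain ⟨⟨k1, k2⟩, k3, k4⟩ := integrable_sum_prod_sum_iff.1 hk
  obtain ⟨⟨l1, l2⟩, l3, l4⟩ := integrable_sum_prod_sum_iff.1 hl
  simp only [diffForm]
  rw [integral_sub k1 l1, integral_sub k2 l2, integral_sub k3 l3, integral_sub k4 l4]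
  ring

theorem diffForm_add_const {k : Plane × Plane → ℝ} (hk : Integrable k ((μ + ν).prod (μ + ν)))
    (c : ℝ) : diffForm μ ν (fun p => k p + c) = diffForm μ ν k := by
  obtain ⟨⟨k1, k2⟩, k3, k4⟩ := integrable_sum_prod_sum_iff.1 hk
  simp only [diffForm]
  rw [integral_add k1 (integrable_const c), integral_add k2 (integrable_const c),
    integral_add k3 (integrable_const c), integral_add k4 (integrable_const c)]
  simp only [integral_const, probReal_univ, one_smul]
  ring

/-- Functions depending on one variable only are annihilated, since `μ - ν` has mass zero. -/
theorem diffForm_separated {f : Plane → ℝ} (hμ : Integrable f μ) (hν : Integrable f ν) :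
    diffForm μ ν (fun p => f p.1 + f p.2) = 0 := by
  simp only [diffForm]
  rw [integral_add (hμ.comp_fst μ) (hμ.comp_snd μ), integral_add (hν.comp_fst ν) (hν.comp_snd ν),
    integral_add (hμ.comp_fst ν) (hν.comp_snd μ), integral_add (hν.comp_fst μ) (hμ.comp_snd ν)]
  simp only [integral_fun_fst, integral_fun_snd]
  simp
  ring

variable {S : Type*} [MeasurableSpace S] {ρ : Measure S} [SFinite ρ]

theorem integral_integral_prod_swap {m : Measure (Plane × Plane)} [SFinite m]
    {k : S → Plane × Plane → ℝ} (hk : Integrable (Function.uncurry k) (ρ.prod m)) :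
    ∫ p, ∫ s, k s p ∂ρ ∂m = ∫ s, ∫ p, k s p ∂m ∂ρ ∧ Integrable (fun s => ∫ p, k s p ∂m) ρ :=
  ⟨(integral_integral_swap hk).symm, hk.integral_prod_left⟩

/-- `diffForm` commutes with superpositions of kernels dominated by an integrable function of the
parameter. -/
theorem diffForm_integral {k : S → Plane × Plane → ℝ} {g : S → ℝ}
    (hk : Measurable (Function.uncurry k)) (hg : Integrable g ρ)
    (hkg : ∀ᵐ s ∂ρ, ∀ p, |k s p| ≤ g s) :
    diffForm μ ν (fun p => ∫ s, k s p ∂ρ) = ∫ s, diffForm μ ν (k s) ∂ρ ∧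
      Integrable (fun s => diffForm μ ν (k s)) ρ := by
  have hi : ∀ (m : Measure (Plane × Plane)) [IsFiniteMeasure m],
      Integrable (Function.uncurry k) (ρ.prod m) := by
    intro m _
    refine (hg.comp_fst m).mono' hk.aestronglyMeasurable ?_
    exact (Measure.quasiMeasurePreserving_fst.ae hkg).mono fun q hq => hq q.2
  obtain ⟨e1, i1⟩ := integral_integral_prod_swap (hi (μ.prod μ))
  obtain ⟨e2, i2⟩ := integral_integral_prod_swap (hi (ν.prod ν))
  obtain ⟨e3, i3⟩ := integral_integral_prod_swap (hi (μ.prod ν))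
  obtain ⟨e4, i4⟩ := integral_integral_prod_swap (hi (ν.prod μ))
  simp only [diffForm]
  refine ⟨?_, ((i1.add i2).sub i3).sub i4⟩
  have i123 : Integrable (fun s => ∫ p, k s p ∂(μ.prod μ) + ∫ p, k s p ∂(ν.prod ν)
      - ∫ p, k s p ∂(μ.prod ν)) ρ := (i1.add i2).sub i3
  rw [e1, e2, e3, e4, integral_sub i123 i4, integral_sub (i1.fun_add i2) i3, integral_add i1 i2]

theorem diffForm_integral_pos {k : S → Plane × Plane → ℝ} {g : S → ℝ}
    (hk : Measurable (Function.uncurry k)) (hg : Integrable g ρ)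
    (hkg : ∀ᵐ s ∂ρ, ∀ p, |k s p| ≤ g s) (h0 : ∀ᵐ s ∂ρ, 0 ≤ diffForm μ ν (k s))
    (hpos : 0 < ρ {s | 0 < diffForm μ ν (k s)}) :
    0 < diffForm μ ν (fun p => ∫ s, k s p ∂ρ) := by
  obtain ⟨h1, h2⟩ := diffForm_integral (μ := μ) (ν := ν) hk hg hkg
  rw [h1, integral_pos_iff_support_of_nonneg_ae h0 h2]
  exact hpos.trans_le (measure_mono fun s (hs : 0 < _) => hs.ne')

theorem diffForm_cos (ξ : Plane) :
    diffForm μ ν (fun p => Real.cos (inner ℝ (p.1 - p.2) ξ))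
      = ‖charFun μ ξ - charFun ν ξ‖ ^ 2 := by
  have hc : ∀ (m : Measure Plane) [IsProbabilityMeasure m],
      Integrable (fun x => Real.cos (inner ℝ x ξ)) m := fun m _ =>
    Integrable.of_bound (C := 1) (by fun_prop : Continuous fun x : Plane =>
      Real.cos (inner ℝ x ξ)).aestronglyMeasurable (ae_of_all _ fun x => Real.abs_cos_le_one _)
  have hs : ∀ (m : Measure Plane) [IsProbabilityMeasure m],
      Integrable (fun x => Real.sin (inner ℝ x ξ)) m := fun m _ =>
    Integrable.of_bound (C := 1) (by fun_prop : Continuous fun x : Plane =>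
      Real.sin (inner ℝ x ξ)).aestronglyMeasurable (ae_of_all _ fun x => Real.abs_sin_le_one _)
  have hprod : ∀ (m n : Measure Plane) [IsProbabilityMeasure m] [IsProbabilityMeasure n],
      ∫ p, Real.cos (inner ℝ (p.1 - p.2) ξ) ∂(m.prod n)
        = (∫ x, Real.cos (inner ℝ x ξ) ∂m) * (∫ x, Real.cos (inner ℝ x ξ) ∂n)
          + (∫ x, Real.sin (inner ℝ x ξ) ∂m) * (∫ x, Real.sin (inner ℝ x ξ) ∂n) := by
    intro m n _ _
    simp only [inner_sub_left, Real.cos_sub]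
    rw [integral_add ((hc m).mul_prod (hc n)) ((hs m).mul_prod (hs n)),
      integral_prod_mul (fun x : Plane => Real.cos (inner ℝ x ξ)) fun x => Real.cos (inner ℝ x ξ),
      integral_prod_mul (fun x : Plane => Real.sin (inner ℝ x ξ)) fun x => Real.sin (inner ℝ x ξ)]
  have hchar : ∀ (m : Measure Plane) [IsProbabilityMeasure m], charFun m ξ
      = ((∫ x, Real.cos (inner ℝ x ξ) ∂m : ℝ) : ℂ)
        + ((∫ x, Real.sin (inner ℝ x ξ) ∂m : ℝ) : ℂ) * Complex.I := by
    intro m _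
    rw [charFun_apply, ← integral_complex_ofReal, ← integral_complex_ofReal,
      ← integral_mul_const, ← integral_add (hc m).ofReal ((hs m).ofReal.mul_const _)]
    refine integral_congr_ae (ae_of_all _ fun x => ?_)
    simp [Complex.exp_mul_I]
  simp only [diffForm, hprod]
  rw [hchar μ, hchar ν, ← Complex.normSq_eq_norm_sq, Complex.normSq_apply]
  simp
  ring

end diffForm

/-! ### Gaussian integrals -/

theorem integrable_sq_mul_exp_neg_mul_sq {b : ℝ} (hb : 0 < b) :
    Integrable (fun x : ℝ => x ^ 2 * Real.exp (-b * x ^ 2)) := by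
  have := integrable_rpow_mul_exp_neg_mul_sq hb (s := 2) (by norm_num)
  simpa using this

theorem integrable_mul_cos {f : ℝ → ℝ} (hf : Integrable f) (u : ℝ) :
    Integrable fun x => f x * Real.cos (u * x) :=
  hf.mul_bdd (c := 1) (by fun_prop : Continuous fun x => Real.cos (u * x)).aestronglyMeasurable
    (ae_of_all _ fun _ => Real.abs_cos_le_one _)

theorem integrable_mul_sin {f : ℝ → ℝ} (hf : Integrable f) (u : ℝ) :
    Integrable fun x => f x * Real.sin (u * x) :=
  hf.mul_bdd (c := 1) (by fun_prop : Continuous fun x => Real.sin (u * x)).aestronglyMeasurable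
    (ae_of_all _ fun _ => Real.abs_sin_le_one _)

theorem integral_exp_neg_mul_sq_mul_cos {b : ℝ} (hb : 0 < b) (u : ℝ) :
    ∫ x : ℝ, Real.exp (-b * x ^ 2) * Real.cos (u * x)
      = √(Real.pi / b) * Real.exp (-u ^ 2 / (4 * b)) := by
  have h := fourierIntegral_gaussian (b := (b : ℂ)) (by simpa using hb) u
  have hr : ((Real.pi : ℂ) / b) ^ (1 / 2 : ℂ) * Complex.exp (-(u : ℂ) ^ 2 / (4 * b))
      = ((√(Real.pi / b) * Real.exp (-u ^ 2 / (4 * b)) : ℝ) : ℂ) := by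
    rw [Real.sqrt_eq_rpow, Complex.ofReal_mul, Complex.ofReal_cpow (by positivity)]
    push_cast
    rfl
  have hi : Integrable fun x : ℝ =>
      Complex.exp (Complex.I * u * x) * Complex.exp (-b * x ^ 2) := by
    refine (integrable_cexp_neg_mul_sq (b := (b : ℂ)) (by simpa using hb)).bdd_mul (c := 1)
      (by fun_prop : Continuous fun x : ℝ => Complex.exp (Complex.I * u * x)).aestronglyMeasurable
      (ae_of_all _ fun x => ?_)
    rw [show Complex.I * u * x = ((u * x : ℝ) : ℂ) * Complex.I by push_cast; ring,
      Complex.norm_exp_ofReal_mul_I]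
  rw [hr] at h
  have := congrArg Complex.re h
  rw [Complex.ofReal_re, ← RCLike.re_eq_complex_re, ← integral_re hi] at this
  rw [← this]
  refine integral_congr_ae (ae_of_all _ fun x => ?_)
  simp only [RCLike.re_eq_complex_re]
  rw [show Complex.I * u * x = ((u * x : ℝ) : ℂ) * Complex.I by push_cast; ring,
    show (-b * x ^ 2 : ℂ) = ((-b * x ^ 2 : ℝ) : ℂ) by push_cast; ring, ← Complex.ofReal_exp,
    Complex.re_mul_ofReal, Complex.exp_ofReal_mul_I_re]
  ring

/-- Integration by parts, twice, reduces the second moment to `integral_exp_neg_mul_sq_mul_cos`. -/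
theorem integral_sq_mul_exp_neg_mul_sq_mul_cos {b : ℝ} (hb : 0 < b) (u : ℝ) :
    ∫ x : ℝ, x ^ 2 * Real.exp (-b * x ^ 2) * Real.cos (u * x)
      = (1 / (2 * b) - u ^ 2 / (4 * b ^ 2))
        * (√(Real.pi / b) * Real.exp (-u ^ 2 / (4 * b))) := by
  have i0 := integrable_exp_neg_mul_sq hb
  have i1 := integrable_mul_exp_neg_mul_sq hb
  have i2 := integrable_sq_mul_exp_neg_mul_sq hb
  have hexp : ∀ x : ℝ, HasDerivAt (fun x => Real.exp (-b * x ^ 2))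
      (Real.exp (-b * x ^ 2) * (-b * (2 * x))) x := fun x => by
    simpa using ((hasDerivAt_pow 2 x).const_mul (-b)).exp
  -- integrate the derivatives of `exp (-b x²) sin (u x)` and of `x exp (-b x²) cos (u x)`
  have hsin : ∀ x : ℝ, HasDerivAt (fun x => Real.sin (u * x)) (Real.cos (u * x) * u) x :=
    fun x => by simpa using ((hasDerivAt_id x).const_mul u).sin
  have hcos : ∀ x : ℝ, HasDerivAt (fun x => Real.cos (u * x)) (-Real.sin (u * x) * u) x :=
    fun x => by simpa using ((hasDerivAt_id x).const_mul u).cos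
  have e1 := integral_eq_zero_of_hasDerivAt_of_integrable
    (f := fun x => Real.exp (-b * x ^ 2) * Real.sin (u * x))
    (f' := fun x => u * (Real.exp (-b * x ^ 2) * Real.cos (u * x))
      - 2 * b * (x * Real.exp (-b * x ^ 2) * Real.sin (u * x)))
    (fun x => ((hexp x).mul (hsin x)).congr_deriv (by ring))
    (((integrable_mul_cos i0 u).const_mul _).sub ((integrable_mul_sin i1 u).const_mul _))
    (integrable_mul_sin i0 u)
  have e2 := integral_eq_zero_of_hasDerivAt_of_integrable
    (f := fun x => x * Real.exp (-b * x ^ 2) * Real.cos (u * x))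
    (f' := fun x => (Real.exp (-b * x ^ 2) * Real.cos (u * x)
      - 2 * b * (x ^ 2 * Real.exp (-b * x ^ 2) * Real.cos (u * x)))
      - u * (x * Real.exp (-b * x ^ 2) * Real.sin (u * x)))
    (fun x => (((hasDerivAt_id x).mul (hexp x)).mul (hcos x)).congr_deriv (by simp; ring))
    (((integrable_mul_cos i0 u).sub ((integrable_mul_cos i2 u).const_mul _)).sub
      ((integrable_mul_sin i1 u).const_mul _))
    (integrable_mul_cos i1 u)
  rw [integral_sub ((integrable_mul_cos i0 u).const_mul _) ((integrable_mul_sin i1 u).const_mul _),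
    integral_const_mul, integral_const_mul] at e1
  have i02 : Integrable fun x : ℝ => Real.exp (-b * x ^ 2) * Real.cos (u * x)
      - 2 * b * (x ^ 2 * Real.exp (-b * x ^ 2) * Real.cos (u * x)) :=
    (integrable_mul_cos i0 u).sub ((integrable_mul_cos i2 u).const_mul _)
  rw [integral_sub i02 ((integrable_mul_sin i1 u).const_mul _),
    integral_sub (integrable_mul_cos i0 u)
    ((integrable_mul_cos i2 u).const_mul _), integral_const_mul, integral_const_mul] at e2
  rw [← integral_exp_neg_mul_sq_mul_cos hb u]
  generalize ∫ x : ℝ, Real.exp (-b * x ^ 2) * Real.cos (u * x) = A at *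
  generalize ∫ x : ℝ, x * Real.exp (-b * x ^ 2) * Real.sin (u * x) = B at *
  generalize ∫ x : ℝ, x ^ 2 * Real.exp (-b * x ^ 2) * Real.cos (u * x) = D at *
  have hB : B = u * A / (2 * b) := by field_simp; linarith
  rw [hB] at e2
  field_simp at e2 ⊢
  linarith

theorem integral_exp_neg_mul_sq_mul_sin (b u : ℝ) :
    ∫ x : ℝ, Real.exp (-b * x ^ 2) * Real.sin (u * x) = 0 := by
  have h := integral_neg_eq_self (fun x : ℝ => Real.exp (-b * x ^ 2) * Real.sin (u * x)) volume
  simp only [neg_sq, mul_neg, Real.sin_neg, integral_neg] at h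
  linarith

/-- The quadratic form `(1 - α) a² + (1 + α) c²`. Divided by `|ξ|⁴`, it is a constant multiple
of the Fourier transform of `W_α` away from the origin. -/
def anisoForm (α a c : ℝ) : ℝ := (1 - α) * a ^ 2 + (1 + α) * c ^ 2

theorem anisoForm_nonneg {α : ℝ} (hα : α ∈ Set.Icc (0 : ℝ) 1) (a c : ℝ) : 0 ≤ anisoForm α a c := by
  have h1 : 0 ≤ 1 - α := sub_nonneg.2 hα.2
  have h2 : 0 ≤ 1 + α := by linarith [hα.1]
  unfold anisoForm
  positivity

theorem anisoForm_le {α : ℝ} (hα : α ∈ Set.Icc (0 : ℝ) 1) (a c : ℝ) :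
    anisoForm α a c ≤ 2 * (a ^ 2 + c ^ 2) := by
  unfold anisoForm
  nlinarith [hα.1, hα.2, sq_nonneg a, sq_nonneg c]

theorem integrable_anisoForm_mul_exp (α : ℝ) {b : ℝ} (hb : 0 < b) :
    Integrable fun ξ : ℝ × ℝ =>
      anisoForm α ξ.1 ξ.2 * (Real.exp (-b * ξ.1 ^ 2) * Real.exp (-b * ξ.2 ^ 2)) := by
  have i0 := integrable_exp_neg_mul_sq hb
  have i2 := integrable_sq_mul_exp_neg_mul_sq hb
  refine (((i2.mul_prod i0).const_mul (1 - α)).add ((i0.mul_prod i2).const_mul (1 + α))).congr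
    (ae_of_all _ fun ξ => ?_)
  simp only [anisoForm, Pi.add_apply]
  ring

/-- The Fourier transform of `anisoForm` times a Gaussian. -/
theorem integral_anisoForm_mul_exp_mul_cos (α : ℝ) {b : ℝ} (hb : 0 < b) (u v : ℝ) :
    ∫ ξ : ℝ × ℝ, anisoForm α ξ.1 ξ.2 * (Real.exp (-b * ξ.1 ^ 2) * Real.exp (-b * ξ.2 ^ 2))
        * Real.cos (u * ξ.1 + v * ξ.2)
      = Real.pi / b * (1 / b - anisoForm α u v / (4 * b ^ 2))
        * Real.exp (-(u ^ 2 + v ^ 2) / (4 * b)) := by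
  have i0 := integrable_exp_neg_mul_sq hb
  have i2 := integrable_sq_mul_exp_neg_mul_sq hb
  have c1 := (integrable_mul_cos i2 u).mul_prod (integrable_mul_cos i0 v)
  have c2 := (integrable_mul_cos i0 u).mul_prod (integrable_mul_cos i2 v)
  have s1 := (integrable_mul_sin i2 u).mul_prod (integrable_mul_sin i0 v)
  have s2 := (integrable_mul_sin i0 u).mul_prod (integrable_mul_sin i2 v)
  have e : ∀ ξ : ℝ × ℝ,
      anisoForm α ξ.1 ξ.2 * (Real.exp (-b * ξ.1 ^ 2) * Real.exp (-b * ξ.2 ^ 2))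
        * Real.cos (u * ξ.1 + v * ξ.2)
      = ((1 - α) * ((ξ.1 ^ 2 * Real.exp (-b * ξ.1 ^ 2) * Real.cos (u * ξ.1))
            * (Real.exp (-b * ξ.2 ^ 2) * Real.cos (v * ξ.2)))
          + (1 + α) * ((Real.exp (-b * ξ.1 ^ 2) * Real.cos (u * ξ.1))
            * (ξ.2 ^ 2 * Real.exp (-b * ξ.2 ^ 2) * Real.cos (v * ξ.2))))
        - ((1 - α) * ((ξ.1 ^ 2 * Real.exp (-b * ξ.1 ^ 2) * Real.sin (u * ξ.1))
            * (Real.exp (-b * ξ.2 ^ 2) * Real.sin (v * ξ.2)))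
          + (1 + α) * ((Real.exp (-b * ξ.1 ^ 2) * Real.sin (u * ξ.1))
            * (ξ.2 ^ 2 * Real.exp (-b * ξ.2 ^ 2) * Real.sin (v * ξ.2)))) := by
    intro ξ
    rw [Real.cos_add, anisoForm]
    ring
  simp only [e]
  rw [Measure.volume_eq_prod,
    integral_sub ((c1.const_mul _).fun_add (c2.const_mul _))
      ((s1.const_mul _).fun_add (s2.const_mul _)),
    integral_add (c1.const_mul _) (c2.const_mul _), integral_add (s1.const_mul _) (s2.const_mul _)]
  simp only [integral_const_mul]
  rw [integral_prod_mul (fun x : ℝ => x ^ 2 * Real.exp (-b * x ^ 2) * Real.cos (u * x))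
      fun x => Real.exp (-b * x ^ 2) * Real.cos (v * x),
    integral_prod_mul (fun x : ℝ => Real.exp (-b * x ^ 2) * Real.cos (u * x))
      fun x => x ^ 2 * Real.exp (-b * x ^ 2) * Real.cos (v * x),
    integral_prod_mul (fun x : ℝ => x ^ 2 * Real.exp (-b * x ^ 2) * Real.sin (u * x))
      fun x => Real.exp (-b * x ^ 2) * Real.sin (v * x),
    integral_prod_mul (fun x : ℝ => Real.exp (-b * x ^ 2) * Real.sin (u * x))
      fun x => x ^ 2 * Real.exp (-b * x ^ 2) * Real.sin (v * x)]
  simp only [integral_exp_neg_mul_sq_mul_sin, integral_exp_neg_mul_sq_mul_cos hb,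
    integral_sq_mul_exp_neg_mul_sq_mul_cos hb]
  have hs : √(Real.pi / b) * √(Real.pi / b) = Real.pi / b :=
    Real.mul_self_sqrt (by positivity)
  have he : Real.exp (-(u ^ 2 + v ^ 2) / (4 * b))
      = Real.exp (-u ^ 2 / (4 * b)) * Real.exp (-v ^ 2 / (4 * b)) := by
    rw [← Real.exp_add]
    ring_nf
  generalize √(Real.pi / b) = w at hs ⊢
  rw [he, ← hs, anisoForm]
  ring

/-! ### Strict positivity of the regularised kernels -/

/-- The kernel `(1 - t q(x - y)) exp (-t |x - y|²)`, with `q = anisoForm α`. -/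
noncomputable def gaussKernel (α t : ℝ) (p : Plane × Plane) : ℝ :=
  (1 - t * anisoForm α ((p.1 - p.2) 0) ((p.1 - p.2) 1)) * Real.exp (-t * ‖p.1 - p.2‖ ^ 2)

theorem gaussKernel_eq_integral (α : ℝ) {t : ℝ} (ht : 0 < t) (p : Plane × Plane) :
    gaussKernel α t p = 1 / (16 * Real.pi * t ^ 2) * ∫ ξ : ℝ × ℝ, anisoForm α ξ.1 ξ.2 *
      (Real.exp (-(1 / (4 * t)) * ξ.1 ^ 2) * Real.exp (-(1 / (4 * t)) * ξ.2 ^ 2))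
        * Real.cos (inner ℝ (p.1 - p.2) !₂[ξ.1, ξ.2]) := by
  have e : ∀ ξ : ℝ × ℝ, inner ℝ (p.1 - p.2) (!₂[ξ.1, ξ.2] : Plane)
      = (p.1 - p.2) 0 * ξ.1 + (p.1 - p.2) 1 * ξ.2 := fun ξ => by
    simp [PiLp.inner_apply, Fin.sum_univ_two, mul_comm]
  simp only [e]
  rw [integral_anisoForm_mul_exp_mul_cos α (by positivity : 0 < 1 / (4 * t)), gaussKernel,
    Plane.norm_sq_eq]
  have : -t * ((p.1 - p.2) 0 ^ 2 + (p.1 - p.2) 1 ^ 2)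
      = -((p.1 - p.2) 0 ^ 2 + (p.1 - p.2) 1 ^ 2) / (4 * (1 / (4 * t))) := by
    field_simp
  rw [this]
  have := Real.pi_pos
  field_simp
  ring

theorem abs_gaussKernel_le {α : ℝ} (hα : α ∈ Set.Icc (0 : ℝ) 1) {t : ℝ} (ht : 0 ≤ t)
    (p : Plane × Plane) : |gaussKernel α t p| ≤ 3 := by
  have hq0 := anisoForm_nonneg hα ((p.1 - p.2) 0) ((p.1 - p.2) 1)
  have hq := anisoForm_le hα ((p.1 - p.2) 0) ((p.1 - p.2) 1)
  rw [← Plane.norm_sq_eq] at hq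
  unfold gaussKernel
  generalize anisoForm α ((p.1 - p.2) 0) ((p.1 - p.2) 1) = q at *
  generalize hz : ‖p.1 - p.2‖ ^ 2 = z at *
  have hz0 : 0 ≤ z := hz ▸ by positivity
  have h1 : t * z * Real.exp (-t * z) ≤ 1 := by
    have := Real.add_one_le_exp (t * z)
    rw [neg_mul, Real.exp_neg, ← div_eq_mul_inv, div_le_one (Real.exp_pos _)]
    linarith
  have h2 : Real.exp (-t * z) ≤ 1 := Real.exp_le_one_iff.2 (by nlinarith)
  have h3 := Real.exp_pos (-t * z)
  have h4 : t * q * Real.exp (-t * z) ≤ 2 * (t * z * Real.exp (-t * z)) := by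
    have : t * q * Real.exp (-t * z) ≤ t * (2 * z) * Real.exp (-t * z) := by gcongr
    linarith
  have h5 : 0 ≤ t * q * Real.exp (-t * z) := by positivity
  rw [abs_le]
  constructor <;> nlinarith

theorem measurable_gaussKernel (α : ℝ) :
    Measurable (fun z : ℝ × (Plane × Plane) => gaussKernel α z.1 z.2) := by
  unfold gaussKernel anisoForm
  exact (by fun_prop : Continuous _).measurable

/-- The kernel `1 / (|x - y|² + s) - q(x - y) / (|x - y|² + s)²`, with `q = anisoForm α`; it is
`-2` times the `s`-derivative of `regPotential`. -/
noncomputable def resolventKernel (α s : ℝ) (p : Plane × Plane) : ℝ :=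
  1 / (‖p.1 - p.2‖ ^ 2 + s)
    - anisoForm α ((p.1 - p.2) 0) ((p.1 - p.2) 1) / (‖p.1 - p.2‖ ^ 2 + s) ^ 2

theorem integral_mul_exp_neg_mul_Ioi {A : ℝ} (hA : 0 < A) (q : ℝ) :
    ∫ t in Set.Ioi (0 : ℝ), (1 - t * q) * Real.exp (-A * t) = 1 / A - q / A ^ 2 := by
  have h1 := integral_exp_mul_Ioi (neg_lt_zero.2 hA) 0
  have h2 := Real.integral_rpow_mul_exp_neg_mul_Ioi (a := 2) (r := A) (by norm_num) hA
  have i1 := integrableOn_exp_mul_Ioi (neg_lt_zero.2 hA) 0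
  have i2 := integrableOn_rpow_mul_exp_neg_mul_rpow (p := 1) (s := 1) (by norm_num)
    one_pos hA
  norm_num at h2 i2
  have i2' : IntegrableOn (fun t : ℝ => t * Real.exp (-A * t)) (Set.Ioi 0) := by
    simpa using i2
  have e : ∀ t : ℝ, (1 - t * q) * Real.exp (-A * t)
      = Real.exp (-A * t) - q * (t * Real.exp (-A * t)) := fun t => by ring
  simp only [e]
  rw [integral_sub i1 (i2'.const_mul q), integral_const_mul, h1]
  simp only [neg_mul] at h2 ⊢
  rw [h2]
  simp
  field_simp

theorem resolventKernel_eq_integral (α : ℝ) {s : ℝ} (hs : 0 < s) (p : Plane × Plane) :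
    resolventKernel α s p
      = ∫ t in Set.Ioi (0 : ℝ), Real.exp (-s * t) * gaussKernel α t p := by
  rw [resolventKernel, ← integral_mul_exp_neg_mul_Ioi (by positivity)]
  refine integral_congr_ae (ae_of_all _ fun t => ?_)
  simp only [gaussKernel]
  rw [show -(‖p.1 - p.2‖ ^ 2 + s) * t = -s * t + -t * ‖p.1 - p.2‖ ^ 2 by ring, Real.exp_add]
  ring

theorem abs_resolventKernel_le {α : ℝ} (hα : α ∈ Set.Icc (0 : ℝ) 1) {s : ℝ} (hs : 0 < s)
    (p : Plane × Plane) : |resolventKernel α s p| ≤ 3 / s := by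
  have hq0 := anisoForm_nonneg hα ((p.1 - p.2) 0) ((p.1 - p.2) 1)
  have hq := anisoForm_le hα ((p.1 - p.2) 0) ((p.1 - p.2) 1)
  rw [← Plane.norm_sq_eq] at hq
  unfold resolventKernel
  generalize anisoForm α ((p.1 - p.2) 0) ((p.1 - p.2) 1) = q at *
  generalize hz : ‖p.1 - p.2‖ ^ 2 = z at *
  have hz0 : 0 ≤ z := hz ▸ by positivity
  have h1 : 1 / (z + s) ≤ 1 / s := by gcongr; linarith
  have h2 : q / (z + s) ^ 2 ≤ 2 / s := by
    rw [div_le_div_iff₀ (by positivity) hs]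
    nlinarith
  have h3 : 0 ≤ 1 / (z + s) := by positivity
  have h4 : 0 ≤ q / (z + s) ^ 2 := by positivity
  have h5 : 3 / s = 1 / s + 2 / s := by ring
  have h6 : 0 < 1 / s := by positivity
  rw [abs_le]
  constructor <;> linarith

theorem measurable_resolventKernel (α : ℝ) :
    Measurable (fun z : ℝ × (Plane × Plane) => resolventKernel α z.1 z.2) := by
  unfold resolventKernel anisoForm
  fun_prop

section Positivity

variable {μ ν : Measure Plane} [IsProbabilityMeasure μ] [IsProbabilityMeasure ν]

/-- By Fourier inversion this is a weighted `L²` norm of the difference of the characteristic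
functions, which is positive because these are continuous and distinct. -/
theorem diffForm_gaussKernel_pos {α : ℝ} (hα : α ∈ Set.Icc (0 : ℝ) 1) (hμν : μ ≠ ν) {t : ℝ}
    (ht : 0 < t) : 0 < diffForm μ ν (gaussKernel α t) := by
  set b : ℝ := 1 / (4 * t) with hb
  have hb0 : 0 < b := by positivity
  set w : ℝ × ℝ → ℝ := fun ξ => anisoForm α ξ.1 ξ.2 *
    (Real.exp (-b * ξ.1 ^ 2) * Real.exp (-b * ξ.2 ^ 2)) with hw
  have hw0 : ∀ ξ, 0 ≤ w ξ := fun ξ => mul_nonneg (anisoForm_nonneg hα _ _) (by positivity)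
  have heq : gaussKernel α t = fun p => 1 / (16 * Real.pi * t ^ 2) *
      ∫ ξ : ℝ × ℝ, w ξ * Real.cos (inner ℝ (p.1 - p.2) !₂[ξ.1, ξ.2]) :=
    funext fun p => gaussKernel_eq_integral α ht p
  have hform : ∀ ξ : ℝ × ℝ, diffForm μ ν
      (fun p => w ξ * Real.cos (inner ℝ (p.1 - p.2) !₂[ξ.1, ξ.2]))
      = w ξ * ‖charFun μ !₂[ξ.1, ξ.2] - charFun ν !₂[ξ.1, ξ.2]‖ ^ 2 := fun ξ => by
    rw [diffForm_const_mul, diffForm_cos]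
  have hcont : Continuous fun ξ : ℝ × ℝ => (!₂[ξ.1, ξ.2] : Plane) := by fun_prop
  have hwc : Continuous w := by simp only [hw, anisoForm]; fun_prop
  rw [heq, diffForm_const_mul]
  refine mul_pos (by positivity) (diffForm_integral_pos (g := w) ?_
    (integrable_anisoForm_mul_exp α hb0) (ae_of_all _ fun ξ p => ?_) (ae_of_all _ fun ξ => ?_) ?_)
  · refine Continuous.measurable ?_
    simp only [Function.uncurry_def]
    fun_prop
  · rw [abs_mul, abs_of_nonneg (hw0 ξ)]
    exact mul_le_of_le_one_right (hw0 ξ) (Real.abs_cos_le_one _)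
  · rw [hform]
    exact mul_nonneg (hw0 ξ) (by positivity)
  · simp only [hform]
    have hopen : IsOpen {ξ : ℝ × ℝ | charFun μ !₂[ξ.1, ξ.2] ≠ charFun ν !₂[ξ.1, ξ.2]} :=
      isOpen_ne_fun (continuous_charFun.comp hcont) (continuous_charFun.comp hcont)
    have hne : {ξ : ℝ × ℝ | charFun μ !₂[ξ.1, ξ.2] ≠ charFun ν !₂[ξ.1, ξ.2]}.Nonempty := by
      by_contra hempty
      refine hμν (Measure.ext_of_charFun (funext fun x => ?_))
      by_contra hx
      refine hempty ⟨(x 0, x 1), ?_⟩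
      have : (!₂[x 0, x 1] : Plane) = x := by ext i; fin_cases i <;> rfl
      simpa [this] using hx
    have hdense : Dense {ξ : ℝ × ℝ | ξ.2 ≠ 0} :=
      (dense_compl_singleton (0 : ℝ)).preimage isOpenMap_snd
    have hopen' : IsOpen {ξ : ℝ × ℝ | ξ.2 ≠ 0} := isOpen_ne_fun continuous_snd continuous_const
    refine ((hopen.inter hopen').measure_pos volume
      (hdense.inter_open_nonempty _ hopen hne)).trans_le (measure_mono fun ξ hξ => ?_)
    have hξ1 : 0 < ‖charFun μ !₂[ξ.1, ξ.2] - charFun ν !₂[ξ.1, ξ.2]‖ :=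
      norm_pos_iff.2 (sub_ne_zero.2 hξ.1)
    have hξ2 : 0 < anisoForm α ξ.1 ξ.2 := by
      have h1 : 0 ≤ 1 - α := sub_nonneg.2 hα.2
      have h2 : 0 < 1 + α := by linarith [hα.1]
      have h3 : 0 < ξ.2 ^ 2 := sq_pos_of_ne_zero (a := ξ.2) hξ.2
      unfold anisoForm
      positivity
    simp only [Set.mem_ofPred_eq, hw]
    positivity

theorem diffForm_resolventKernel_pos {α : ℝ} (hα : α ∈ Set.Icc (0 : ℝ) 1) (hμν : μ ≠ ν) {s : ℝ}
    (hs : 0 < s) : 0 < diffForm μ ν (resolventKernel α s) := by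
  have heq : resolventKernel α s
      = fun p => ∫ t in Set.Ioi (0 : ℝ), Real.exp (-s * t) * gaussKernel α t p :=
    funext fun p => resolventKernel_eq_integral α hs p
  have hpos : ∀ t ∈ Set.Ioi (0 : ℝ),
      0 < diffForm μ ν (fun p => Real.exp (-s * t) * gaussKernel α t p) := fun t ht => by
    rw [diffForm_const_mul]
    exact mul_pos (Real.exp_pos _) (diffForm_gaussKernel_pos hα hμν ht)
  rw [heq]
  refine diffForm_integral_pos (g := fun t => Real.exp (-s * t) * 3) ?_
    ((integrableOn_exp_mul_Ioi (neg_lt_zero.2 hs) 0).mul_const 3) ?_ ?_ ?_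
  · exact (by fun_prop : Measurable fun z : ℝ × (Plane × Plane) => Real.exp (-s * z.1)).mul
      (measurable_gaussKernel α)
  · refine (ae_restrict_mem measurableSet_Ioi).mono fun t ht p => ?_
    rw [abs_mul, Real.abs_exp]
    gcongr
    exact abs_gaussKernel_le hα (le_of_lt ht) p
  · exact (ae_restrict_mem measurableSet_Ioi).mono fun t ht => (hpos t ht).le
  · refine lt_of_lt_of_le ?_ (measure_mono fun t ht => hpos t ht)
    simp

/-- The regularisation
`W_ε(x - y) = -½ log (|x - y|² + ε) - ½ q(x - y) / (|x - y|² + ε) + (1 + α)/2`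
of `W_α(x - y)`, with `q = anisoForm α`. -/
noncomputable def regPotential (α ε : ℝ) (p : Plane × Plane) : ℝ :=
  -(1 / 2) * Real.log (‖p.1 - p.2‖ ^ 2 + ε)
    - 1 / 2 * (anisoForm α ((p.1 - p.2) 0) ((p.1 - p.2) 1) / (‖p.1 - p.2‖ ^ 2 + ε)) + (1 + α) / 2

theorem integral_resolventKernel (α : ℝ) {a c : ℝ} (ha : 0 < a) (hac : a ≤ c) (p : Plane × Plane) :
    ∫ s in Set.Ioc a c, 1 / 2 * resolventKernel α s p
      = regPotential α a p - regPotential α c p := by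
  rw [← intervalIntegral.integral_of_le hac]
  have hpos : ∀ s ∈ Set.uIcc a c, 0 < ‖p.1 - p.2‖ ^ 2 + s := fun s hs => by
    rw [Set.uIcc_of_le hac] at hs
    have := ha.trans_le hs.1
    positivity
  have hd : ∀ s ∈ Set.uIcc a c, HasDerivAt (fun s => -regPotential α s p)
      (1 / 2 * resolventKernel α s p) s := fun s hs => by
    have h1 : HasDerivAt (fun s => ‖p.1 - p.2‖ ^ 2 + s) 1 s := (hasDerivAt_id s).const_add _
    have h2 := ((h1.log (hpos s hs).ne').const_mul (-(1 / 2))).sub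
      (((h1.inv (hpos s hs).ne').const_mul
        (anisoForm α ((p.1 - p.2) 0) ((p.1 - p.2) 1))).const_mul (1 / 2))
    refine ((h2.add_const ((1 + α) / 2)).neg).congr_deriv ?_
    rw [resolventKernel]
    ring
  rw [intervalIntegral.integral_eq_sub_of_hasDerivAt hd]
  · ring
  · refine ContinuousOn.intervalIntegrable fun s hs => ?_
    have := (hpos s hs).ne'
    have h' : (‖p.1 - p.2‖ ^ 2 + s) ^ 2 ≠ 0 := by positivity
    unfold resolventKernel
    exact ContinuousAt.continuousWithinAt (by fun_prop (disch := assumption))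

end Positivity

section RegPotential

variable {α : ℝ} (hα : α ∈ Set.Icc (0 : ℝ) 1)
include hα

theorem anisoForm_le_mul (a c : ℝ) : anisoForm α a c ≤ (1 + α) * (a ^ 2 + c ^ 2) := by
  unfold anisoForm
  nlinarith [hα.1, sq_nonneg a]

theorem half_anisoForm_div_mem {s : ℝ} (hs : 0 < s) (x : Plane) :
    1 / 2 * (anisoForm α (x 0) (x 1) / (‖x‖ ^ 2 + s)) ∈ Set.Icc 0 ((1 + α) / 2) := by
  have hq0 := anisoForm_nonneg hα (x 0) (x 1)
  have hq := anisoForm_le_mul hα (x 0) (x 1)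
  rw [← Plane.norm_sq_eq] at hq
  have h1 : anisoForm α (x 0) (x 1) / (‖x‖ ^ 2 + s) ≤ 1 + α := by
    rw [div_le_iff₀ (by positivity)]
    nlinarith [hα.1]
  have h2 : 0 ≤ anisoForm α (x 0) (x 1) / (‖x‖ ^ 2 + s) := by positivity
  constructor <;> linarith

theorem abs_regPotential_add_log_le {R : ℝ} (hR : 0 < R) (p : Plane × Plane) :
    |regPotential α R p + 1 / 2 * Real.log R| ≤ ‖p.1 - p.2‖ ^ 2 / R + 1 := by
  obtain ⟨h1, h2⟩ := half_anisoForm_div_mem hα hR (p.1 - p.2)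
  have hz : 0 ≤ ‖p.1 - p.2‖ ^ 2 := by positivity
  have h3 : Real.log R ≤ Real.log (‖p.1 - p.2‖ ^ 2 + R) := Real.log_le_log hR (by linarith)
  have h4 := Real.log_le_sub_one_of_pos (x := (‖p.1 - p.2‖ ^ 2 + R) / R) (by positivity)
  rw [Real.log_div (by positivity) hR.ne', add_div, div_self hR.ne'] at h4
  have h5 := hα.2
  have h6 : 0 ≤ ‖p.1 - p.2‖ ^ 2 / R := by positivity
  unfold regPotential
  rw [abs_le]
  constructor <;> linarith

omit hα in
theorem continuous_regPotential {ε : ℝ} (hε : 0 < ε) : Continuous (regPotential α ε) := by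
  have h : ∀ p : Plane × Plane, ‖p.1 - p.2‖ ^ 2 + ε ≠ 0 := fun p => by positivity
  unfold regPotential anisoForm
  fun_prop (disch := assumption)

omit hα in
theorem tendsto_regPotential_add_log (p : Plane × Plane) :
    Tendsto (fun R => regPotential α R p + 1 / 2 * Real.log R) atTop (𝓝 ((1 + α) / 2)) := by
  have h1 : Tendsto (fun R : ℝ => ‖p.1 - p.2‖ ^ 2 + R) atTop atTop :=
    tendsto_atTop_add_const_left _ _ tendsto_id
  have h2 := (tendsto_const_nhds (x := anisoForm α ((p.1 - p.2) 0) ((p.1 - p.2) 1))).div_atTop h1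
  have h3 : Tendsto (fun R : ℝ => ‖p.1 - p.2‖ ^ 2 / R + 1) atTop (𝓝 1) := by
    simpa using (tendsto_const_nhds (x := ‖p.1 - p.2‖ ^ 2)).div_atTop tendsto_id |>.add_const 1
  have h4 := (((h3.log one_ne_zero).const_mul (-(1 / 2))).sub (h2.const_mul (1 / 2))).add_const
    ((1 + α) / 2)
  simp only [Real.log_one, mul_zero, sub_zero, zero_add] at h4
  refine h4.congr' ?_
  filter_upwards [eventually_gt_atTop 0] with R hR
  have : ‖p.1 - p.2‖ ^ 2 / R + 1 = (‖p.1 - p.2‖ ^ 2 + R) / R := by field_simp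
  rw [this, Real.log_div (by positivity) hR.ne', regPotential]
  ring

variable {μ ν : Measure Plane} [IsProbabilityMeasure μ] [IsProbabilityMeasure ν]

omit hα in
theorem integrable_norm_sub_sq (hμ : Integrable (fun x : Plane => ‖x‖ ^ 2) μ)
    (hν : Integrable (fun x : Plane => ‖x‖ ^ 2) ν) :
    Integrable (fun p : Plane × Plane => ‖p.1 - p.2‖ ^ 2) (μ.prod ν) := by
  refine (((hμ.comp_fst ν).add (hν.comp_snd μ)).const_mul 2).mono'
    (by fun_prop : Continuous fun p : Plane × Plane => ‖p.1 - p.2‖ ^ 2).aestronglyMeasurable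
    (ae_of_all _ fun p => ?_)
  rw [Real.norm_of_nonneg (by positivity)]
  exact Plane.norm_sub_sq_le _ _

theorem integrable_regPotential (hμ : Integrable (fun x : Plane => ‖x‖ ^ 2) μ)
    (hν : Integrable (fun x : Plane => ‖x‖ ^ 2) ν) {ε : ℝ} (hε : 0 < ε) :
    Integrable (regPotential α ε) (μ.prod ν) := by
  have h : Integrable (fun p => regPotential α ε p + 1 / 2 * Real.log ε) (μ.prod ν) :=
    (((integrable_norm_sub_sq hμ hν).div_const ε).add (integrable_const 1)).mono'
      ((continuous_regPotential hε).add continuous_const).aestronglyMeasurable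
      (ae_of_all _ fun p => abs_regPotential_add_log_le hα hε p)
  exact (h.sub (integrable_const (1 / 2 * Real.log ε))).congr
    (ae_of_all _ fun p => by simp)

theorem integrable_regPotential_sum (hμ : Integrable (fun x : Plane => ‖x‖ ^ 2) μ)
    (hν : Integrable (fun x : Plane => ‖x‖ ^ 2) ν) {ε : ℝ} (hε : 0 < ε) :
    Integrable (regPotential α ε) ((μ + ν).prod (μ + ν)) :=
  integrable_sum_prod_sum_iff.2
    ⟨⟨integrable_regPotential hα hμ hμ hε, integrable_regPotential hα hν hν hε⟩,
      integrable_regPotential hα hμ hν hε, integrable_regPotential hα hν hμ hε⟩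

/-- For large `R`, the kernel `regPotential α R` is constant up to a small error, and constants do
not contribute because `μ - ν` has mass zero. -/
theorem tendsto_diffForm_regPotential (hμ : Integrable (fun x : Plane => ‖x‖ ^ 2) μ)
    (hν : Integrable (fun x : Plane => ‖x‖ ^ 2) ν) :
    Tendsto (fun R => diffForm μ ν (regPotential α R)) atTop (𝓝 0) := by
  have key : ∀ (m n : Measure Plane) [IsProbabilityMeasure m] [IsProbabilityMeasure n],
      Integrable (fun x : Plane => ‖x‖ ^ 2) m → Integrable (fun x : Plane => ‖x‖ ^ 2) n →
      Tendsto (fun R => ∫ p, (regPotential α R p + 1 / 2 * Real.log R) ∂(m.prod n)) atTop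
        (𝓝 ((1 + α) / 2)) := by
    intro m n _ _ hm hn
    have := tendsto_integral_filter_of_dominated_convergence (μ := m.prod n) (l := atTop)
      (F := fun R p => regPotential α R p + 1 / 2 * Real.log R) (f := fun _ => (1 + α) / 2)
      (fun p => ‖p.1 - p.2‖ ^ 2 + 1)
      ((eventually_gt_atTop 0).mono fun R hR =>
        ((continuous_regPotential hR).add continuous_const).aestronglyMeasurable)
      ((eventually_ge_atTop 1).mono fun R hR => ae_of_all _ fun p =>
        (abs_regPotential_add_log_le hα (zero_lt_one.trans_le hR) p).trans
          (add_le_add_left (div_le_self (by positivity) hR) 1))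
      ((integrable_norm_sub_sq hm hn).add (integrable_const 1))
      (ae_of_all _ fun p => tendsto_regPotential_add_log p)
    simpa using this
  have h := (((key μ μ hμ hμ).add (key ν ν hν hν)).sub (key μ ν hμ hν)).sub (key ν μ hν hμ)
  rw [show (1 + α) / 2 + (1 + α) / 2 - (1 + α) / 2 - (1 + α) / 2 = 0 by ring] at h
  refine h.congr' ((eventually_gt_atTop 0).mono fun R hR => ?_)
  exact diffForm_add_const (integrable_regPotential_sum hα hμ hν hR) _

theorem diffForm_regPotential_lt (hμν : μ ≠ ν) (hμ : Integrable (fun x : Plane => ‖x‖ ^ 2) μ)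
    (hν : Integrable (fun x : Plane => ‖x‖ ^ 2) ν) {a c : ℝ} (ha : 0 < a) (hac : a < c) :
    diffForm μ ν (regPotential α c) < diffForm μ ν (regPotential α a) := by
  rw [← sub_pos, ← diffForm_sub (integrable_regPotential_sum hα hμ hν ha)
    (integrable_regPotential_sum hα hμ hν (ha.trans hac))]
  simp only [← integral_resolventKernel α ha hac.le]
  have hpos : ∀ s ∈ Set.Ioc a c, 0 < diffForm μ ν (fun p => 1 / 2 * resolventKernel α s p) :=
    fun s hs => by
      rw [diffForm_const_mul]
      exact mul_pos (by norm_num) (diffForm_resolventKernel_pos hα hμν (ha.trans hs.1))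
  refine diffForm_integral_pos (g := fun _ => 3 / a) ?_ (integrable_const _) ?_ ?_ ?_
  · exact measurable_const.mul (measurable_resolventKernel α)
  · refine (ae_restrict_mem measurableSet_Ioc).mono fun s hs p => ?_
    have h1 := abs_resolventKernel_le hα (ha.trans hs.1) p
    have h2 : 3 / s ≤ 3 / a := div_le_div_of_nonneg_left (by norm_num) ha hs.1.le
    rw [abs_mul, abs_of_pos (by norm_num : (0 : ℝ) < 1 / 2)]
    linarith [abs_nonneg (resolventKernel α s p)]
  · exact (ae_restrict_mem measurableSet_Ioc).mono fun s hs => (hpos s hs).le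
  · refine lt_of_lt_of_le ?_ (measure_mono fun t ht => hpos t ht)
    simpa using hac

theorem diffForm_regPotential_pos (hμν : μ ≠ ν) (hμ : Integrable (fun x : Plane => ‖x‖ ^ 2) μ)
    (hν : Integrable (fun x : Plane => ‖x‖ ^ 2) ν) {a : ℝ} (ha : 0 < a) :
    0 < diffForm μ ν (regPotential α a) := by
  refine lt_of_le_of_lt ?_ (diffForm_regPotential_lt hα hμν hμ hν ha (lt_add_one a))
  refine le_of_tendsto (tendsto_diffForm_regPotential hα hμ hν) ?_
  filter_upwards [eventually_gt_atTop (a + 1)] with R hR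
  exact (diffForm_regPotential_lt hα hμν hμ hν (by linarith) hR).le

/-! ### Removing the regularisation -/

/-- The regularisation of `shiftedKernel`, as a real function. -/
noncomputable def regKernel (α ε : ℝ) (p : Plane × Plane) : ℝ :=
  regPotential α ε p + (‖p.1‖ ^ 2 / 2 + 1 / 2 + (‖p.2‖ ^ 2 / 2 + 1 / 2))

theorem regKernel_nonneg {ε : ℝ} (hε : 0 < ε) (hε1 : ε ≤ 1) (p : Plane × Plane) :
    0 ≤ regKernel α ε p := by
  obtain ⟨h1, h2⟩ := half_anisoForm_div_mem hα hε (p.1 - p.2)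
  have hz : 0 ≤ ‖p.1 - p.2‖ ^ 2 := by positivity
  have h3 : Real.log (‖p.1 - p.2‖ ^ 2 + ε) ≤ Real.log (1 + ‖p.1 - p.2‖ ^ 2) :=
    Real.log_le_log (by positivity) (by linarith)
  have h4 := Real.half_log_le_eighth _ hz
  have h5 := Plane.norm_sub_sq_le p.1 p.2
  unfold regKernel regPotential
  linarith

theorem regKernel_le {ε : ℝ} (hε : 0 < ε) (p : Plane × Plane) :
    ENNReal.ofReal (regKernel α ε p) ≤ shiftedKernel α p + 1 := by
  unfold shiftedKernel
  split_ifs with h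
  · simp
  · have hpos := Plane.sq_add_sq_pos (sub_ne_zero.2 h)
    obtain ⟨h1, h2⟩ := half_anisoForm_div_mem hα hε (p.1 - p.2)
    have h3 : Real.log ((p.1 - p.2) 0 ^ 2 + (p.1 - p.2) 1 ^ 2)
        ≤ Real.log (‖p.1 - p.2‖ ^ 2 + ε) := by
      rw [Plane.norm_sq_eq]
      exact Real.log_le_log hpos (by linarith)
    have h4 : 0 ≤ α * ((p.1 - p.2) 0 ^ 2 / ((p.1 - p.2) 0 ^ 2 + (p.1 - p.2) 1 ^ 2)) :=
      mul_nonneg hα.1 (by positivity)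
    have h5 := realPotential_lower_bound hα.1 h
    rw [← ENNReal.ofReal_one, ← ENNReal.ofReal_add (le_trans (by positivity) h5) zero_le_one]
    refine ENNReal.ofReal_le_ofReal ?_
    have := hα.2
    unfold regKernel regPotential realPotential
    linarith

omit hα in
theorem tendsto_regKernel (p : Plane × Plane) :
    Tendsto (fun ε => ENNReal.ofReal (regKernel α ε p)) (𝓝[>] 0) (𝓝 (shiftedKernel α p)) := by
  unfold shiftedKernel
  split_ifs with h
  · refine ENNReal.tendsto_ofReal_nhds_top.2 ?_
    have h1 : ∀ ε, regKernel α ε p = -(1 / 2) * Real.log ε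
        + ((1 + α) / 2 + (‖p.1‖ ^ 2 / 2 + 1 / 2 + (‖p.2‖ ^ 2 / 2 + 1 / 2))) := fun ε => by
      simp [regKernel, regPotential, h, anisoForm, add_assoc]
    simp only [h1]
    exact tendsto_atTop_add_const_right _ _
      (Real.tendsto_log_nhdsGT_zero.const_mul_atBot_of_neg (by norm_num))
  · refine ENNReal.tendsto_ofReal ?_
    have hpos := Plane.sq_add_sq_pos (sub_ne_zero.2 h)
    have hz : ‖p.1 - p.2‖ ^ 2 + 0 ≠ 0 := by rw [add_zero, Plane.norm_sq_eq]; exact hpos.ne'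
    have hc : ContinuousAt (fun ε => regKernel α ε p) 0 := by
      unfold regKernel regPotential
      fun_prop (disch := assumption)
    have e : regKernel α 0 p
        = realPotential α (p.1 - p.2) + (‖p.1‖ ^ 2 + ‖p.2‖ ^ 2) / 2 + 1 := by
      unfold regKernel regPotential realPotential anisoForm
      rw [add_zero, Plane.norm_sq_eq (p.1 - p.2)]
      field_simp
      ring
    rw [← e]
    exact hc.tendsto.mono_left nhdsWithin_le_nhds

theorem lintegral_regKernel_add_le (hμ : Integrable (fun x : Plane => ‖x‖ ^ 2) μ)
    (hν : Integrable (fun x : Plane => ‖x‖ ^ 2) ν) {ε : ℝ} (hε : 0 < ε) (hε1 : ε ≤ 1)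
    {δ : ℝ} (hδ : 0 ≤ δ) (h : δ ≤ diffForm μ ν (regPotential α ε)) :
    ∫⁻ p, ENNReal.ofReal (regKernel α ε p) ∂(μ.prod ν + ν.prod μ) + ENNReal.ofReal δ
      ≤ ∫⁻ p, ENNReal.ofReal (regKernel α ε p) ∂(μ.prod μ + ν.prod ν) := by
  have hf : ∀ (m : Measure Plane) [IsProbabilityMeasure m],
      Integrable (fun x : Plane => ‖x‖ ^ 2) m →
      Integrable (fun x : Plane => ‖x‖ ^ 2 / 2 + 1 / 2) m := fun m _ hm =>
    (hm.div_const 2).add (integrable_const _)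
  have hK : ∀ (m n : Measure Plane) [IsProbabilityMeasure m] [IsProbabilityMeasure n],
      Integrable (fun x : Plane => ‖x‖ ^ 2) m → Integrable (fun x : Plane => ‖x‖ ^ 2) n →
      Integrable (regKernel α ε) (m.prod n) := fun m n _ _ hm hn =>
    (integrable_regPotential hα hm hn hε).add
      (((hf m hm).comp_fst n).add ((hf n hn).comp_snd m))
  have hl : ∀ (m n : Measure Plane) [IsProbabilityMeasure m] [IsProbabilityMeasure n],
      Integrable (fun x : Plane => ‖x‖ ^ 2) m → Integrable (fun x : Plane => ‖x‖ ^ 2) n →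
      ∫⁻ p, ENNReal.ofReal (regKernel α ε p) ∂(m.prod n)
        = ENNReal.ofReal (∫ p, regKernel α ε p ∂(m.prod n)) := fun m n _ _ hm hn =>
    (ofReal_integral_eq_lintegral_ofReal (hK m n hm hn)
      (ae_of_all _ fun p => regKernel_nonneg hα hε hε1 p)).symm
  have h0 : ∀ m : Measure (Plane × Plane), 0 ≤ ∫ p, regKernel α ε p ∂m := fun m =>
    integral_nonneg fun p => regKernel_nonneg hα hε hε1 p
  have hd : diffForm μ ν (regPotential α ε) = diffForm μ ν (regKernel α ε) := by
    have h1 := diffForm_sub (μ := μ) (ν := ν) (k := regKernel α ε)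
      (l := fun p => ‖p.1‖ ^ 2 / 2 + 1 / 2 + (‖p.2‖ ^ 2 / 2 + 1 / 2))
      (integrable_sum_prod_sum_iff.2 ⟨⟨hK μ μ hμ hμ, hK ν ν hν hν⟩, hK μ ν hμ hν, hK ν μ hν hμ⟩)
      (integrable_sum_prod_sum_iff.2
        ⟨⟨((hf μ hμ).comp_fst μ).add ((hf μ hμ).comp_snd μ),
          ((hf ν hν).comp_fst ν).add ((hf ν hν).comp_snd ν)⟩,
          ((hf μ hμ).comp_fst ν).add ((hf ν hν).comp_snd μ),
          ((hf ν hν).comp_fst μ).add ((hf μ hμ).comp_snd ν)⟩)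
    rw [diffForm_separated (f := fun x => ‖x‖ ^ 2 / 2 + 1 / 2) (hf μ hμ) (hf ν hν), sub_zero] at h1
    rw [← h1]
    simp only [regKernel, add_sub_cancel_right]
  rw [lintegral_add_measure, lintegral_add_measure, hl μ ν hμ hν, hl ν μ hν hμ, hl μ μ hμ hμ,
    hl ν ν hν hν, ← ENNReal.ofReal_add (h0 _) (h0 _), ← ENNReal.ofReal_add (h0 _) (h0 _),
    ← ENNReal.ofReal_add (add_nonneg (h0 _) (h0 _)) hδ]
  refine ENNReal.ofReal_le_ofReal ?_
  rw [hd, diffForm] at h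
  linarith

omit hα in
theorem mutualEnergy_comm (α : ℝ) (μ ν : Measure Plane) [SFinite μ] [SFinite ν] :
    mutualEnergy α μ ν = mutualEnergy α ν μ := by
  unfold mutualEnergy
  rw [← lintegral_prod_swap]
  simp only [shiftedKernel_swap]

/-- Strict positivity of the energy of `μ - ν`. The regularised energies are at least a fixed
`δ > 0`; as `ε → 0`, the cross terms are handled by Fatou's lemma and the diagonal terms by
dominated convergence, so that finiteness of the cross term is a consequence. -/
theorem two_mul_mutualEnergy_lt (hμν : μ ≠ ν) (hμ : mutualEnergy α μ μ ≠ ⊤)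
    (hν : mutualEnergy α ν ν ≠ ⊤) :
    2 * mutualEnergy α μ ν < mutualEnergy α μ μ + mutualEnergy α ν ν := by
  have iμ := integrable_norm_sq_of_mutualEnergy hα.1 hμ
  have iν := integrable_norm_sq_of_mutualEnergy hα.1 hν
  set δ := diffForm μ ν (regPotential α 1)
  have hδ : 0 < δ := diffForm_regPotential_pos hα hμν iμ iν one_pos
  set e : ℕ → ℝ := fun n => 1 / ((n : ℝ) + 1)
  have he0 : ∀ n, 0 < e n := fun n => by positivity
  have he1 : ∀ n, e n ≤ 1 := fun n => by
    simp only [e]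
    rw [div_le_one (by positivity)]
    linarith [(Nat.cast_nonneg n : (0 : ℝ) ≤ n)]
  have he : Tendsto e atTop (𝓝[>] 0) :=
    tendsto_nhdsWithin_iff.2 ⟨tendsto_one_div_add_atTop_nhds_zero_nat, Eventually.of_forall he0⟩
  have hδe : ∀ n, δ ≤ diffForm μ ν (regPotential α (e n)) := fun n => by
    rcases (he1 n).eq_or_lt with h | h
    · rw [h]
    · exact (diffForm_regPotential_lt hα hμν iμ iν (he0 n) h).le
  have hlim : ∀ p, Tendsto (fun n => ENNReal.ofReal (regKernel α (e n) p)) atTop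
      (𝓝 (shiftedKernel α p)) := fun p => (tendsto_regKernel p).comp he
  have hmeas : ∀ n, Measurable fun p => ENNReal.ofReal (regKernel α (e n) p) := fun n => by
    refine Measurable.ennreal_ofReal ?_
    exact ((continuous_regPotential (he0 n)).add (by fun_prop)).measurable
  set m₁ := μ.prod ν + ν.prod μ
  set m₂ := μ.prod μ + ν.prod ν
  have hB : ∫⁻ p, shiftedKernel α p ∂m₂ = mutualEnergy α μ μ + mutualEnergy α ν ν :=
    lintegral_add_measure _ _ _
  have hBtop : mutualEnergy α μ μ + mutualEnergy α ν ν ≠ ⊤ := ENNReal.add_ne_top.2 ⟨hμ, hν⟩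
  have hA : ∫⁻ p, shiftedKernel α p ∂m₁ = 2 * mutualEnergy α μ ν := by
    rw [lintegral_add_measure, two_mul]
    congr 1
    exact mutualEnergy_comm α ν μ
  have hdiag : Tendsto (fun n => ∫⁻ p, ENNReal.ofReal (regKernel α (e n) p) ∂m₂) atTop
      (𝓝 (mutualEnergy α μ μ + mutualEnergy α ν ν)) := by
    rw [← hB]
    refine tendsto_lintegral_of_dominated_convergence (fun p => shiftedKernel α p + 1) hmeas
      (fun n => ae_of_all _ fun p => regKernel_le hα (he0 n) p) ?_ (ae_of_all _ hlim)
    rw [lintegral_add_right _ measurable_const, hB]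
    exact ENNReal.add_ne_top.2 ⟨hBtop, by simp⟩
  have hineq : ∀ n, ∫⁻ p, ENNReal.ofReal (regKernel α (e n) p) ∂m₁ + ENNReal.ofReal δ
      ≤ ∫⁻ p, ENNReal.ofReal (regKernel α (e n) p) ∂m₂ := fun n =>
    lintegral_regKernel_add_le hα iμ iν (he0 n) (he1 n) hδ.le (hδe n)
  have hcross : 2 * mutualEnergy α μ ν
      ≤ mutualEnergy α μ μ + mutualEnergy α ν ν - ENNReal.ofReal δ := by
    have h1 := (ENNReal.Tendsto.sub hdiag (tendsto_const_nhds (x := ENNReal.ofReal δ))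
      (Or.inl hBtop)).liminf_eq
    rw [← h1, ← hA]
    calc ∫⁻ p, shiftedKernel α p ∂m₁
        = ∫⁻ p, liminf (fun n => ENNReal.ofReal (regKernel α (e n) p)) atTop ∂m₁ :=
          lintegral_congr fun p => (hlim p).liminf_eq.symm
      _ ≤ liminf (fun n => ∫⁻ p, ENNReal.ofReal (regKernel α (e n) p) ∂m₁) atTop :=
          lintegral_liminf_le hmeas
      _ ≤ _ := liminf_le_liminf (Eventually.of_forall fun n =>
          ENNReal.le_sub_of_add_le_right ENNReal.ofReal_ne_top (hineq n))
  have hδB : ENNReal.ofReal δ ≤ mutualEnergy α μ μ + mutualEnergy α ν ν :=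
    ge_of_tendsto' hdiag fun n => le_add_self.trans (hineq n)
  have hδ' : 0 < ENNReal.ofReal δ := ENNReal.ofReal_pos.2 hδ
  exact hcross.trans_lt (ENNReal.sub_lt_self hBtop (hδ'.trans_le hδB).ne' hδ'.ne')

end RegPotential

/-! ### Lower semicontinuity and tightness -/

theorem le_shiftedKernel_of_pos {α : ℝ} (hα : 0 ≤ α) {ε : ℝ} (hε : 0 < ε) (p : Plane × Plane) :
    ENNReal.ofReal (-(1 / 2) * Real.log (‖p.1 - p.2‖ ^ 2 + ε)) ≤ shiftedKernel α p := by
  unfold shiftedKernel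
  split_ifs with h
  · exact le_top
  · have hpos := Plane.sq_add_sq_pos (sub_ne_zero.2 h)
    refine ENNReal.ofReal_le_ofReal ?_
    have h3 : Real.log ((p.1 - p.2) 0 ^ 2 + (p.1 - p.2) 1 ^ 2)
        ≤ Real.log (‖p.1 - p.2‖ ^ 2 + ε) := by
      rw [Plane.norm_sq_eq]
      exact Real.log_le_log hpos (by linarith)
    have h4 : 0 ≤ α * ((p.1 - p.2) 0 ^ 2 / ((p.1 - p.2) 0 ^ 2 + (p.1 - p.2) 1 ^ 2)) := by
      positivity
    have h5 : 0 ≤ (‖p.1‖ ^ 2 + ‖p.2‖ ^ 2) / 2 := by positivity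
    unfold realPotential
    linarith

theorem continuous_shiftedKernel {α : ℝ} (hα : 0 ≤ α) : Continuous (shiftedKernel α) := by
  refine continuous_iff_continuousAt.2 fun p => ?_
  by_cases h : p.1 = p.2
  · have hp : shiftedKernel α p = ⊤ := if_pos h
    rw [ContinuousAt, hp]
    refine ENNReal.tendsto_nhds_top fun n => ?_
    -- `-½ log (|x - y|² + ε)` exceeds `n` near the diagonal, for this choice of `ε`
    set ε := Real.exp (-(2 * (n + 1)))
    have hε : 0 < ε := Real.exp_pos _
    have hc : ContinuousAt
        (fun p : Plane × Plane => -(1 / 2) * Real.log (‖p.1 - p.2‖ ^ 2 + ε)) p := by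
      have : ‖p.1 - p.2‖ ^ 2 + ε ≠ 0 := by positivity
      fun_prop (disch := assumption)
    have hv : (n : ℝ) < -(1 / 2) * Real.log (‖p.1 - p.2‖ ^ 2 + ε) := by
      simp only [h, sub_self, norm_zero, ε]
      norm_num
      linarith
    filter_upwards [hc.eventually_const_lt hv] with x hx
    refine lt_of_lt_of_le ?_ (le_shiftedKernel_of_pos hα hε x)
    rw [← ENNReal.ofReal_natCast]
    exact (ENNReal.ofReal_lt_ofReal_iff_of_nonneg (by positivity)).2 hx
  · have hz : (p.1 - p.2) 0 ^ 2 + (p.1 - p.2) 1 ^ 2 ≠ 0 :=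
      (Plane.sq_add_sq_pos (sub_ne_zero.2 h)).ne'
    have hc : ContinuousAt (fun p : Plane × Plane => ENNReal.ofReal
        (realPotential α (p.1 - p.2) + (‖p.1‖ ^ 2 + ‖p.2‖ ^ 2) / 2 + 1)) p := by
      refine ENNReal.continuous_ofReal.continuousAt.comp ?_
      unfold realPotential
      fun_prop (disch := assumption)
    refine hc.congr ?_
    filter_upwards [(isOpen_ne_fun continuous_fst continuous_snd).mem_nhds h] with x hx
    exact (if_neg hx).symm

/-- The energy is a supremum of the integrals of the bounded continuous functions
`min (shiftedKernel α) n`. -/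
theorem lowerSemicontinuous_mutualEnergy {α : ℝ} (hα : 0 ≤ α) :
    LowerSemicontinuous fun μ : ProbabilityMeasure Plane => mutualEnergy α μ μ := by
  have hcont := continuous_shiftedKernel hα
  have hsup : ∀ μ : ProbabilityMeasure Plane, mutualEnergy α μ μ
      = ⨆ n : ℕ, ∫⁻ p, min (shiftedKernel α p) n ∂(μ.prod μ : ProbabilityMeasure _) := fun μ => by
    rw [← lintegral_iSup (fun n => (hcont.min continuous_const).measurable)
      (fun m n hmn p => min_le_min_left _ (by exact_mod_cast hmn))]
    refine lintegral_congr fun p => ?_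
    rw [← inf_iSup_eq (shiftedKernel α p) fun n : ℕ => (n : ℝ≥0∞), ENNReal.iSup_natCast, inf_top_eq]
  simp only [hsup]
  refine lowerSemicontinuous_iSup fun n => Continuous.lowerSemicontinuous ?_
  have hne : ∀ p, min (shiftedKernel α p) n ≠ ⊤ := fun p =>
    ne_top_of_le_ne_top (ENNReal.natCast_ne_top n) (min_le_right _ _)
  let f : BoundedContinuousFunction (Plane × Plane) ℝ≥0 :=
    BoundedContinuousFunction.mkOfBound
      ⟨fun p => (min (shiftedKernel α p) n).toNNReal,
        ENNReal.continuousOn_toNNReal.comp_continuous (hcont.min continuous_const) hne⟩ n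
      (fun x y => by
        have hb : ∀ p, (min (shiftedKernel α p) n).toNNReal ≤ (n : ℝ≥0) := fun p =>
          ENNReal.coe_le_coe.1 (by
            rw [ENNReal.coe_toNNReal (hne p)]
            exact_mod_cast min_le_right _ _)
        have hx : (((min (shiftedKernel α x) n).toNNReal : ℝ≥0) : ℝ) ≤ n := by exact_mod_cast hb x
        have hy : (((min (shiftedKernel α y) n).toNNReal : ℝ≥0) : ℝ) ≤ n := by exact_mod_cast hb y
        rw [ContinuousMap.coe_mk, NNReal.dist_eq, abs_le]
        constructor <;> linarith [NNReal.coe_nonneg (min (shiftedKernel α x) n).toNNReal,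
          NNReal.coe_nonneg (min (shiftedKernel α y) n).toNNReal])
  have hf : ∀ p, ((f p : ℝ≥0) : ℝ≥0∞) = min (shiftedKernel α p) n := fun p =>
    ENNReal.coe_toNNReal (hne p)
  simp only [← hf]
  exact (ProbabilityMeasure.continuous_lintegral_boundedContinuousFunction f).comp
    (ProbabilityMeasure.continuous_prod.comp (continuous_id.prodMk continuous_id))

theorem measure_norm_gt_le {α : ℝ} (hα : 0 ≤ α) (μ : Measure Plane) [IsProbabilityMeasure μ]
    {r : ℝ} (hr : 0 < r) :
    μ {x | r < ‖x‖} ≤ mutualEnergy α μ μ / ENNReal.ofReal (r ^ 2 / 4) := by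
  have hpos : 0 < r ^ 2 / 4 := by positivity
  have h1 : μ {x | r < ‖x‖} ≤ (μ.prod μ) {p | ENNReal.ofReal (r ^ 2 / 4) ≤ shiftedKernel α p} := by
    have : μ {x | r < ‖x‖} = (μ.prod μ) ({x | r < ‖x‖} ×ˢ Set.univ) := by
      rw [Measure.prod_prod, measure_univ, mul_one]
    rw [this]
    refine measure_mono fun p hp => ?_
    refine le_trans (ENNReal.ofReal_le_ofReal ?_) (le_shiftedKernel hα p)
    have hp' : r < ‖p.1‖ := hp.1
    nlinarith [sq_nonneg ‖p.2‖]
  refine h1.trans ?_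
  exact meas_ge_le_lintegral_div (continuous_shiftedKernel hα).aemeasurable
    (ENNReal.ofReal_pos.2 hpos).ne' ENNReal.ofReal_ne_top

theorem isCompact_mutualEnergy_le {α : ℝ} (hα : 0 ≤ α) {c : ℝ≥0∞} (hc : c ≠ ⊤) :
    IsCompact {μ : ProbabilityMeasure Plane | mutualEnergy α μ μ ≤ c} := by
  have hclosed : IsClosed {μ : ProbabilityMeasure Plane | mutualEnergy α μ μ ≤ c} :=
    (lowerSemicontinuous_mutualEnergy hα).isClosed_preimage c
  rw [← hclosed.closure_eq]
  refine isCompact_closure_of_isTightMeasureSet (isTightMeasureSet_of_tendsto_measure_norm_gt ?_)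
  have hlim : Tendsto (fun r : ℝ => c / ENNReal.ofReal (r ^ 2 / 4)) atTop (𝓝 0) := by
    have h1 : Tendsto (fun r : ℝ => r ^ 2 / 4) atTop atTop :=
      (tendsto_pow_atTop two_ne_zero).atTop_div_const (by norm_num)
    have h2 := ENNReal.tendsto_ofReal_nhds_top.2 h1
    simpa using ENNReal.Tendsto.const_div h2 (Or.inr hc)
  refine tendsto_of_tendsto_of_tendsto_of_le_of_le' tendsto_const_nhds hlim
    (Eventually.of_forall fun _ => zero_le) ?_
  filter_upwards [eventually_gt_atTop 0] with r hr
  refine iSup₂_le ?_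
  rintro _ ⟨μ, hμ, rfl⟩
  exact (measure_norm_gt_le hα _ hr).trans (ENNReal.div_le_div_right hμ _)

/-! ### A measure of finite energy -/

/-- The uniform probability measure on the segment `[0, 1] × {0}`. -/
noncomputable def segmentMeasure : Measure Plane :=
  (volume.restrict (Set.Icc (0 : ℝ) 1)).map fun t => !₂[t, 0]

theorem measurable_segment : Measurable fun t : ℝ => (!₂[t, 0] : Plane) :=
  (by fun_prop : Continuous fun t : ℝ => (!₂[t, 0] : Plane)).measurable

instance : IsProbabilityMeasure (volume.restrict (Set.Icc (0 : ℝ) 1)) := ⟨by simp⟩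

instance : IsProbabilityMeasure segmentMeasure :=
  Measure.isProbabilityMeasure_map measurable_segment.aemeasurable

theorem shiftedKernel_segment_le {α : ℝ} (hα : α ∈ Set.Icc (0 : ℝ) 1) {s t : ℝ}
    (hs : s ∈ Set.Icc (0 : ℝ) 1) (ht : t ∈ Set.Icc (0 : ℝ) 1) (hst : t ≠ s) :
    shiftedKernel α (!₂[s, 0], !₂[t, 0]) ≤ ENNReal.ofReal (3 - Real.log (t - s)) := by
  have hne : (!₂[s, 0] : Plane) ≠ !₂[t, 0] := fun h => hst (by
    have := congrFun (congrArg WithLp.ofLp h) 0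
    simpa using this.symm)
  rw [shiftedKernel, if_neg hne]
  refine ENNReal.ofReal_le_ofReal ?_
  have hpos : 0 < (s - t) ^ 2 := by have := sub_ne_zero.2 hst.symm; positivity
  have hlog : Real.log (s - t) = Real.log (t - s) := by
    rw [← Real.log_abs, abs_sub_comm, Real.log_abs]
  simp only [realPotential, Plane.norm_sq_eq, PiLp.sub_apply]
  simp only [Matrix.cons_val_zero, Matrix.cons_val_one, sub_self]
  norm_num
  rw [hlog, div_self hpos.ne']
  nlinarith [hs.1, hs.2, ht.1, ht.2, hα.2]

theorem mutualEnergy_segmentMeasure_ne_top {α : ℝ} (hα : α ∈ Set.Icc (0 : ℝ) 1) :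
    mutualEnergy α segmentMeasure segmentMeasure ≠ ⊤ := by
  have hm : Measurable (shiftedKernel α) := (continuous_shiftedKernel hα.1).measurable
  have hint : ∫⁻ u in Set.Icc (-1 : ℝ) 1, ENNReal.ofReal (3 - Real.log u) ≠ ⊤ := by
    have h1 : IntervalIntegrable (fun u => 3 - Real.log u) volume (-1) 1 :=
      intervalIntegrable_const.sub intervalIntegral.intervalIntegrable_log'
    have h2 := (intervalIntegrable_iff_integrableOn_Icc_of_le (by norm_num)).1 h1
    exact (h2.lintegral_lt_top).ne
  refine ne_top_of_le_ne_top hint ?_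
  have hinner : ∀ s ∈ Set.Icc (0 : ℝ) 1,
      ∫⁻ t in Set.Icc (0 : ℝ) 1, shiftedKernel α (!₂[s, 0], !₂[t, 0])
        ≤ ∫⁻ u in Set.Icc (-1 : ℝ) 1, ENNReal.ofReal (3 - Real.log u) := by
    intro s hs
    calc ∫⁻ t in Set.Icc (0 : ℝ) 1, shiftedKernel α (!₂[s, 0], !₂[t, 0])
        ≤ ∫⁻ t in Set.Icc (0 : ℝ) 1, ENNReal.ofReal (3 - Real.log (t - s)) := by
          refine lintegral_mono_ae ?_
          filter_upwards [ae_restrict_mem measurableSet_Icc,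
            ae_restrict_of_ae (Measure.ae_ne volume s)] with t ht hts
          exact shiftedKernel_segment_le hα hs ht hts
      _ ≤ ∫⁻ t in (fun t => t - s) ⁻¹' Set.Icc (-1 : ℝ) 1,
            ENNReal.ofReal (3 - Real.log (t - s)) := by
          refine lintegral_mono_set fun t ht => ?_
          simp only [Set.mem_preimage, Set.mem_Icc] at ht hs ⊢
          constructor <;> linarith
      _ = ∫⁻ u in Set.Icc (-1 : ℝ) 1, ENNReal.ofReal (3 - Real.log u) :=
          (measurePreserving_sub_right volume s).setLIntegral_comp_preimage measurableSet_Icc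
            (by fun_prop : Measurable fun u : ℝ => ENNReal.ofReal (3 - Real.log u))
  rw [mutualEnergy, lintegral_prod _ hm.aemeasurable, segmentMeasure,
    lintegral_map hm.lintegral_prod_right' measurable_segment]
  calc ∫⁻ s in Set.Icc (0 : ℝ) 1, ∫⁻ y, shiftedKernel α (!₂[s, 0], y)
          ∂((volume.restrict (Set.Icc (0 : ℝ) 1)).map fun t => !₂[t, 0])
      ≤ ∫⁻ s in Set.Icc (0 : ℝ) 1, ∫⁻ u in Set.Icc (-1 : ℝ) 1,
          ENNReal.ofReal (3 - Real.log u) := by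
        refine setLIntegral_mono' measurableSet_Icc fun s hs => ?_
        have hs' : Measurable fun y => shiftedKernel α (!₂[s, 0], y) :=
          hm.comp measurable_prodMk_left
        rw [lintegral_map hs' measurable_segment]
        exact hinner s hs
    _ = ∫⁻ u in Set.Icc (-1 : ℝ) 1, ENNReal.ofReal (3 - Real.log u) := by
        simp

/-! ### Minimisers -/

theorem exists_mutualEnergy_minimiser {α : ℝ} (hα : α ∈ Set.Icc (0 : ℝ) 1) :
    ∃ μ : Measure Plane, IsProbabilityMeasure μ ∧ mutualEnergy α μ μ ≠ ⊤ ∧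
      ∀ ν : Measure Plane, IsProbabilityMeasure ν → mutualEnergy α μ μ ≤ mutualEnergy α ν ν := by
  set c := mutualEnergy α segmentMeasure segmentMeasure
  have hc : c ≠ ⊤ := mutualEnergy_segmentMeasure_ne_top hα
  obtain ⟨μ, hμc, hμ⟩ := ((lowerSemicontinuous_mutualEnergy hα.1).lowerSemicontinuousOn
    {μ : ProbabilityMeasure Plane | mutualEnergy α μ μ ≤ c}).exists_isMinOn
    ⟨⟨segmentMeasure, inferInstance⟩, le_refl c⟩ (isCompact_mutualEnergy_le hα.1 hc)
  refine ⟨μ, inferInstance, ne_top_of_le_ne_top hc hμc, fun ν hν => ?_⟩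
  by_cases h : mutualEnergy α ν ν ≤ c
  · exact hμ (show (⟨ν, hν⟩ : ProbabilityMeasure Plane) ∈ _ from h)
  · exact le_trans hμc (le_of_not_ge h)

/-- Outside `B × B`, with `B` a large ball, the kernel exceeds the minimal energy, so conditioning a
minimiser on `B` would decrease its energy unless it is carried by `B` already. -/
theorem isCompact_support_of_minimiser {α : ℝ} (hα : 0 ≤ α) {μ : Measure Plane}
    [IsProbabilityMeasure μ] (hμ : mutualEnergy α μ μ ≠ ⊤)
    (hmin : ∀ ν : Measure Plane, IsProbabilityMeasure ν →
      mutualEnergy α μ μ ≤ mutualEnergy α ν ν) :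
    IsCompact μ.support := by
  set E := mutualEnergy α μ μ with hE
  -- chosen so that `R² / 4`, a lower bound of the kernel outside `B × B`, exceeds `E`
  set R : ℝ := 2 * (E.toReal + 1) with hR
  set B : Set Plane := Metric.closedBall 0 R with hB
  have hBm : MeasurableSet B := Metric.isClosed_closedBall.measurableSet
  set L : ℝ≥0∞ := ENNReal.ofReal (R ^ 2 / 4) with hL
  have hE0 : 0 ≤ E.toReal := ENNReal.toReal_nonneg
  have hEL : E < L := by
    rw [← ENNReal.ofReal_toReal hμ]
    exact (ENNReal.ofReal_lt_ofReal_iff_of_nonneg hE0).2 (by rw [hR]; nlinarith)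
  set m := μ B with hm
  have hmtop : m ≠ ⊤ := measure_ne_top μ B
  have hin : m * m * E ≤ ∫⁻ p in B ×ˢ B, shiftedKernel α p ∂(μ.prod μ) := by
    rcases eq_or_ne m 0 with h0 | h0
    · simp [h0]
    have hν : IsProbabilityMeasure (m⁻¹ • μ.restrict B) :=
      ⟨by simp [← hm, ENNReal.inv_mul_cancel h0 hmtop]⟩
    have h1 := hmin _ hν
    rw [mutualEnergy, Measure.prod_smul_left, Measure.prod_smul_right, Measure.prod_restrict,
      lintegral_smul_measure, lintegral_smul_measure, smul_eq_mul, smul_eq_mul] at h1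
    calc m * m * E ≤ m * m * (m⁻¹ * (m⁻¹ * ∫⁻ p in B ×ˢ B, shiftedKernel α p ∂(μ.prod μ))) := by
          gcongr
      _ = (m * m⁻¹) * (m * m⁻¹) * ∫⁻ p in B ×ˢ B, shiftedKernel α p ∂(μ.prod μ) := by ring
      _ = _ := by rw [ENNReal.mul_inv_cancel h0 hmtop, one_mul, one_mul]
  set a := (μ.prod μ) (B ×ˢ B)ᶜ with ha
  have hout : L * a ≤ ∫⁻ p in (B ×ˢ B)ᶜ, shiftedKernel α p ∂(μ.prod μ) := by
    rw [ha, ← setLIntegral_const]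
    refine setLIntegral_mono' (hBm.prod hBm).compl fun p hp => ?_
    refine le_trans (ENNReal.ofReal_le_ofReal ?_) (le_shiftedKernel hα p)
    have hR0 : 0 ≤ R := by positivity
    have hp' : R < ‖p.1‖ ∨ R < ‖p.2‖ := by
      by_contra! h
      exact hp ⟨mem_closedBall_zero_iff.2 h.1, mem_closedBall_zero_iff.2 h.2⟩
    rcases hp' with h | h
    · nlinarith [sq_nonneg ‖p.2‖]
    · nlinarith [sq_nonneg ‖p.1‖]
  have hsum : m * m + a = 1 := by
    rw [hm, ← Measure.prod_prod, ha, prob_add_prob_compl (hBm.prod hBm)]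
  have hle : m * m * E + L * a ≤ m * m * E + E * a := by
    calc m * m * E + L * a
        ≤ ∫⁻ p in B ×ˢ B, shiftedKernel α p ∂(μ.prod μ)
          + ∫⁻ p in (B ×ˢ B)ᶜ, shiftedKernel α p ∂(μ.prod μ) := add_le_add hin hout
      _ = E := lintegral_add_compl _ (hBm.prod hBm)
      _ = m * m * E + E * a := by rw [mul_comm E a, ← add_mul, hsum, one_mul]
  have hle' : L * a ≤ E * a :=
    (ENNReal.add_le_add_iff_left (ENNReal.mul_ne_top (ENNReal.mul_ne_top hmtop hmtop) hμ)).1 hle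
  have ha0 : a = 0 := by
    by_contra h
    exact absurd hle' (not_le.2 (ENNReal.mul_lt_mul_left h (measure_ne_top _ _) hEL))
  rw [ha0, add_zero] at hsum
  have hm1 : m = 1 := le_antisymm prob_le_one
    (hsum ▸ mul_le_of_le_one_right zero_le prob_le_one)
  have hae : B ∈ ae μ := by
    rw [mem_ae_iff]
    exact (prob_compl_eq_zero_iff hBm).2 hm1
  exact (isCompact_closedBall (0 : Plane) R).of_isClosed_subset Measure.isClosed_support
    (Measure.support_subset_of_isClosed Metric.isClosed_closedBall hae)

/-! ### Convexity -/

theorem isProbabilityMeasure_combo {μ ν : Measure Plane} [IsProbabilityMeasure μ]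
    [IsProbabilityMeasure ν] {a b : ℝ≥0} (hab : a + b = 1) :
    IsProbabilityMeasure (a • μ + b • ν) :=
  ⟨by
    change (a : ℝ≥0∞) * μ Set.univ + b * ν Set.univ = 1
    rw [measure_univ, measure_univ, mul_one, mul_one]
    exact_mod_cast hab⟩

theorem support_combo_subset (μ ν : Measure Plane) (a b : ℝ≥0) :
    (a • μ + b • ν).support ⊆ μ.support ∪ ν.support := by
  rw [Measure.support_add]
  exact Set.union_subset_union
    (Measure.smul_absolutelyContinuous (c := (a : ℝ≥0∞))).support_mono
    (Measure.smul_absolutelyContinuous (c := (b : ℝ≥0∞))).support_mono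

theorem mutualEnergy_combo (α : ℝ) (μ ν : Measure Plane) [IsProbabilityMeasure μ]
    [IsProbabilityMeasure ν] (a b : ℝ≥0) :
    mutualEnergy α (a • μ + b • ν) (a • μ + b • ν)
      = a * a * mutualEnergy α μ μ + 2 * (a * b) * mutualEnergy α μ ν
        + b * b * mutualEnergy α ν ν := by
  have e : ∀ (c : ℝ≥0) (m : Measure Plane), c • m = (c : ℝ≥0∞) • m := fun _ _ => rfl
  have hc := mutualEnergy_comm α ν μ
  simp only [mutualEnergy] at hc ⊢
  simp only [Measure.prod_add, Measure.add_prod]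
  simp only [e, Measure.prod_smul_left, Measure.prod_smul_right,
    lintegral_add_measure, lintegral_smul_measure, smul_eq_mul, hc]
  ring

theorem mutualEnergy_ne_top {α : ℝ} (hα : α ∈ Set.Icc (0 : ℝ) 1) {μ ν : Measure Plane}
    [IsProbabilityMeasure μ] [IsProbabilityMeasure ν] (hμ : mutualEnergy α μ μ ≠ ⊤)
    (hν : mutualEnergy α ν ν ≠ ⊤) : mutualEnergy α μ ν ≠ ⊤ := by
  rcases eq_or_ne μ ν with rfl | h
  · exact hμ
  · have := (two_mul_mutualEnergy_lt hα h hμ hν).ne_top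
    rintro h'
    simp [h'] at this

theorem mutualEnergy_combo_ne_top {α : ℝ} (hα : α ∈ Set.Icc (0 : ℝ) 1) {μ ν : Measure Plane}
    [IsProbabilityMeasure μ] [IsProbabilityMeasure ν] (hμ : mutualEnergy α μ μ ≠ ⊤)
    (hν : mutualEnergy α ν ν ≠ ⊤) (a b : ℝ≥0) :
    mutualEnergy α (a • μ + b • ν) (a • μ + b • ν) ≠ ⊤ := by
  have := mutualEnergy_ne_top hα hμ hν
  rw [mutualEnergy_combo]
  finiteness

theorem energy_toReal_combo_lt {α : ℝ} (hα : α ∈ Set.Icc (0 : ℝ) 1) {μ ν : Measure Plane}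
    [IsProbabilityMeasure μ] [IsProbabilityMeasure ν] (hμν : μ ≠ ν) (hμ : mutualEnergy α μ μ ≠ ⊤)
    (hν : mutualEnergy α ν ν ≠ ⊤) {a b : ℝ≥0} (ha : 0 < a) (hb : 0 < b) (hab : a + b = 1) :
    (energy α (a • μ + b • ν)).toReal < a * (energy α μ).toReal + b * (energy α ν).toReal := by
  have := isProbabilityMeasure_combo (μ := μ) (ν := ν) hab
  have hlt := two_mul_mutualEnergy_lt hα hμν hμ hν
  have hx := mutualEnergy_ne_top hα hμ hν
  rw [energy_of_ne_top hα.1 hμ, energy_of_ne_top hα.1 hν,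
    energy_of_ne_top hα.1 (mutualEnergy_combo_ne_top hα hμ hν a b), mutualEnergy_combo]
  generalize mutualEnergy α μ μ = x at *
  generalize mutualEnergy α ν ν = y at *
  generalize mutualEnergy α μ ν = z at *
  lift x to ℝ≥0 using hμ
  lift y to ℝ≥0 using hν
  lift z to ℝ≥0 using hx
  norm_cast at hlt
  have hlt' : (2 : ℝ) * z < x + y := by exact_mod_cast hlt
  have hab' : (a : ℝ) + b = 1 := by exact_mod_cast hab
  have e : ((a : ℝ≥0∞) * a * x + 2 * (a * b) * z + b * b * y)
      = ((a * a * x + 2 * (a * b) * z + b * b * y : ℝ≥0) : ℝ≥0∞) := by push_cast; ring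
  rw [e]
  simp only [EReal.toReal_coe, ENNReal.coe_toReal]
  push_cast
  have hpos : (0 : ℝ) < a * b := by exact_mod_cast mul_pos ha hb
  have hb' : (b : ℝ) = 1 - a := by linarith
  have key : (a : ℝ) * x + b * y - (a * a * x + 2 * (a * b) * z + b * b * y)
      = a * b * (x + y - 2 * z) := by rw [hb']; ring
  nlinarith [mul_pos hpos (sub_pos.2 hlt')]

theorem strictConvexOn_energy {α : ℝ} (hα : α ∈ Set.Icc (0 : ℝ) 1) :
    StrictConvexOn ℝ≥0 (compactFiniteClass α) (fun μ => (energy α μ).toReal) := by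
  constructor
  · intro μ hμ ν hν a b _ _ hab
    obtain ⟨_, hcμ, hfμ⟩ := (mem_compactFiniteClass_iff hα.1).1 hμ
    obtain ⟨_, hcν, hfν⟩ := (mem_compactFiniteClass_iff hα.1).1 hν
    exact (mem_compactFiniteClass_iff hα.1).2 ⟨isProbabilityMeasure_combo hab,
      (hcμ.union hcν).of_isClosed_subset Measure.isClosed_support (support_combo_subset μ ν a b),
      mutualEnergy_combo_ne_top hα hfμ hfν a b⟩
  · intro μ hμ ν hν hμν a b ha hb hab
    obtain ⟨_, -, hfμ⟩ := (mem_compactFiniteClass_iff hα.1).1 hμ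
    obtain ⟨_, -, hfν⟩ := (mem_compactFiniteClass_iff hα.1).1 hν
    exact energy_toReal_combo_lt hα hμν hfμ hfν ha hb hab

theorem isEnergyMinimiser_iff {α : ℝ} (hα : 0 ≤ α) {μ : Measure Plane} :
    IsEnergyMinimiser α μ ↔ IsProbabilityMeasure μ ∧
      ∀ ν : Measure Plane, IsProbabilityMeasure ν →
        mutualEnergy α μ μ ≤ mutualEnergy α ν ν := by
  refine and_congr_right fun (hμ : IsProbabilityMeasure μ) => ?_
  exact forall_congr' fun ν => forall_congr' fun (hν : IsProbabilityMeasure ν) =>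
    energy_le_energy_iff hα

theorem mutualEnergy_minimiser_unique {α : ℝ} (hα : α ∈ Set.Icc (0 : ℝ) 1) {μ ν : Measure Plane}
    [IsProbabilityMeasure μ] [IsProbabilityMeasure ν] (hμ : mutualEnergy α μ μ ≠ ⊤)
    (hμmin : ∀ ρ : Measure Plane, IsProbabilityMeasure ρ →
      mutualEnergy α μ μ ≤ mutualEnergy α ρ ρ)
    (hνμ : mutualEnergy α ν ν ≤ mutualEnergy α μ μ) : ν = μ := by
  by_contra hne
  have hν : mutualEnergy α ν ν ≠ ⊤ := ne_top_of_le_ne_top hμ hνμ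
  have hab : (1 / 2 : ℝ≥0) + 1 / 2 = 1 := add_halves 1
  have := isProbabilityMeasure_combo (μ := μ) (ν := ν) hab
  have hlt := energy_toReal_combo_lt hα (Ne.symm hne) hμ hν (by norm_num) (by norm_num) hab
  have h1 := hμmin _ this
  have hfin := mutualEnergy_combo_ne_top hα hμ hν (1 / 2) (1 / 2)
  rw [energy_of_ne_top hα.1 hμ, energy_of_ne_top hα.1 hν, energy_of_ne_top hα.1 hfin] at hlt
  have h2 := (ENNReal.toReal_le_toReal hμ hfin).2 h1
  have h3 := (ENNReal.toReal_le_toReal hν hμ).2 hνμ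
  simp only [EReal.toReal_coe] at hlt
  push_cast at hlt
  linarith

theorem proposition2p1 (α : ℝ) (hα : α ∈ Set.Icc (0 : ℝ) 1) :
    -- the energy is well defined, with values in `(-∞, +∞]`, and given by its two-term formula
    (∀ μ ∈ probMeasures,
      HasExtIntegral (μ.prod μ) (energyKernel α) ∧ energy α μ ≠ ⊥ ∧
      (secondMoment μ ≠ ⊤ →
        HasExtIntegral (μ.prod μ) (interactionKernel α) ∧ interactionEnergy α μ ≠ ⊥ ∧
        energy α μ = ((1 / 2 : ℝ) : EReal) * interactionEnergy α μ
          + ((1 / 2 : ℝ) : EReal) * secondMoment μ) ∧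
      (secondMoment μ = ⊤ → energy α μ = ⊤)) ∧
    -- it is finite and strictly convex on the given class, which is convex
    ((∀ μ ∈ compactFiniteClass α, energy α μ ≠ ⊤) ∧
      StrictConvexOn ℝ≥0 (compactFiniteClass α) (fun μ => (energy α μ).toReal)) ∧
    -- there is a unique minimiser, with compact support and finite energy
    (∃! μ : Measure Plane, IsEnergyMinimiser α μ) ∧
    (∀ μ : Measure Plane, IsEnergyMinimiser α μ →
      IsCompact μ.support ∧ energy α μ ≠ ⊥ ∧ energy α μ ≠ ⊤) := by
  obtain ⟨μ₀, hp₀, hf₀, hmin₀⟩ := exists_mutualEnergy_minimiser hα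
  refine ⟨fun μ hμ => ?_, ⟨fun μ hμ => ?_, strictConvexOn_energy hα⟩,
    ⟨μ₀, (isEnergyMinimiser_iff hα.1).2 ⟨hp₀, hmin₀⟩, fun ν hν => ?_⟩, fun μ hμ => ?_⟩
  · have : IsProbabilityMeasure μ := hμ
    exact energy_well_defined hα.1 μ
  · obtain ⟨_, -, hf⟩ := (mem_compactFiniteClass_iff hα.1).1 hμ
    exact (energy_ne_top_iff hα.1).2 hf
  · obtain ⟨_, hmin⟩ := (isEnergyMinimiser_iff hα.1).1 hν
    exact mutualEnergy_minimiser_unique hα hf₀ hmin₀ (hmin μ₀ hp₀)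
  · obtain ⟨_, hmin⟩ := (isEnergyMinimiser_iff hα.1).1 hμ
    have hf := ne_top_of_le_ne_top hf₀ (hmin μ₀ hp₀)
    exact ⟨isCompact_support_of_minimiser hα.1 hf hmin, energy_ne_bot hα.1 μ,
      (energy_ne_top_iff hα.1).2 hf⟩
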